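/- Let $f_\theta$, $\theta=(\mu,\sigma)^T\in\Theta=\mathbb R\times(0,\infty)$, be the $\mathcal N(\mu,\sigma^2)$ density, let $\beta,\gamma\ge 0$, and consider testing $H_0:\mu=\mu_0$ against $H_1:\mu\neq\mu_0$ with $\sigma$ unknown, i.e. $g(\theta)=\mu-\mu_0=0$. Let $\theta_0=(\mu_0,\sigma)^T$ with $\sigma>0$ be the true parameter under $H_0$. Write $u_\theta(x)=\frac{\partial}{\partial\theta}\log f_\theta(x)$, $\xi_\beta(\theta)=\int u_\theta f_\theta^{1+\beta}\,dx$, $J_\beta(\theta)=\int u_\theta u_\theta^T f_\theta^{1+\beta}\,dx$, $K_\beta(\theta)=\int u_\theta u_\theta^Tf_\theta^{1+2\beta}\,dx-\xi_\beta(\theta)\xi_\beta(\theta)^T$, $A_\gamma(\theta)=(1+\gamma)\left(\int f_\theta^{\gamma-1}\frac{\partial f_\theta}{\partial\theta_i}\frac{\partial f_\theta}{\partial\theta_j}\,dx\right)_{i,j}$, $G(\theta)=\frac{\partial g}{\partial\theta}$ and $B_\beta=J_\beta^{-1}G\,(G^TJ_\beta^{-1}G)^{-1}G^TJ_\beta^{-1}$.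 For densities $h,f$ let $d_\gamma(h,f)=\int\{f^{1+\gamma}-(1+\tfrac1\gamma)f^\gamma h+\tfrac1\gamma h^{1+\gamma}\}\,dx$ if $\gamma>0$, and $d_0(h,f)=\int h\log(h/f)\,dx$. Let $X_1,X_2,\dots$ be i.i.d. $\mathcal N(\mu_0,\sigma^2)$. Let $Q_n(\theta)=\int f_\theta^{1+\beta}dx-(1+\tfrac1\beta)\frac1n\sum_{k=1}^n f_\theta^\beta(X_k)$ for $\beta>0$, $Q_n(\theta)=-\frac1n\sum_{k=1}^n\log f_\theta(X_k)$ for $\beta=0$, and $\psi_n(\theta)=\frac1n\sum_{k=1}^n u_\theta(X_k)f_\theta^\beta(X_k)-\xi_\beta(\theta)$. Let $\widehat\theta_\beta$ be a (measurable) minimum density power divergence estimator: either, with probability tending to one, it minimizes $Q_n$ over $\Theta$ whenever the minimum is attained, or it is a sequence, consistent for $\theta_0$, of roots of $\psi_n(\theta)=0$ in $\Theta$ (with probability tending to one). Let $\widetilde\theta_\beta$ be a (measurable) restricted minimum density power divergence estimator: likewise either a minimizer of $Q_n$ over $\Theta_0=\{\theta\in\Theta: g(\theta)=0\}$, or a sequence,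 consistent for $\theta_0$, of solutions in $\Theta_0$ of the Lagrange equations $-n\psi_n(\theta)+G(\theta)\lambda_n=0$ for some $\lambda_n\in\mathbb R$. Put $T_\gamma(\widehat\theta_\beta,\widetilde\theta_\beta)=2n\,d_\gamma(f_{\widehat\theta_\beta},f_{\widetilde\theta_\beta})$. Then $$A_\gamma(\theta_0)B_\beta(\theta_0)K_\beta(\theta_0)B_\beta(\theta_0)=\begin{pmatrix}\lambda_1&0\\0&0\end{pmatrix},\qquad \lambda_1=\frac{1}{\sigma^\gamma}\,\frac{(\beta+1)^3}{\sqrt{\gamma+1}\,(2\beta+1)^{3/2}(2\pi)^{\gamma/2}},$$ $\lambda_1\ne 0$ is the only nonzero eigenvalue of this matrix, and as $n\to\infty$ the statistic $T_\gamma(\widehat\theta_\beta,\widetilde\theta_\beta)$ converges in distribution to $\lambda_1\chi^2(1)$, i.e. to $\lambda_1Z^2$ with $Z$ standard normal. In particular, for $\beta=\gamma=0$ one has $\lambda_1=1$ and $T_0(\widehat\theta_0,\widetilde\theta_0)$ converges in distribution to $\chi^2(1)$. -/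

import Mathlib

open MeasureTheory ProbabilityTheory Filter Topology

namespace DPD

noncomputable section

/-! A parametric model is a family of densities `f θ : ℝ → ℝ` (with respect to Lebesgue measure)
indexed by parameter vectors `θ : ι → ℝ`; the parameter space is a set of such vectors. -/

section Model

variable {ι κ : Type*} [Fintype ι] [DecidableEq ι] [Fintype κ] [DecidableEq κ]

/-- The density power divergence `d_γ(h, f)`; for `γ = 0` the Kullback-Leibler divergence. -/
def divergence (γ : ℝ) (h f : ℝ → ℝ) : ℝ :=
  if γ = 0 then ∫ x, h x * Real.log (h x / f x)
  else ∫ x, (f x ^ (1 + γ) - (1 + 1 / γ) * f x ^ γ * h x + 1 / γ * h x ^ (1 + γ))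

/-- The partial derivative `∂F/∂θ_i` at `θ`. -/
def partialDeriv (F : (ι → ℝ) → ℝ) (θ : ι → ℝ) (i : ι) : ℝ :=
  deriv (fun t => F (Function.update θ i t)) (θ i)

/-- The likelihood score `u_θ(x) = ∂/∂θ log f_θ(x)`. -/
def score (f : (ι → ℝ) → ℝ → ℝ) (θ : ι → ℝ) (x : ℝ) (i : ι) : ℝ :=
  partialDeriv (fun θ' => Real.log (f θ' x)) θ i

/-- `ξ_β(θ) = ∫ u_θ f_θ^{1+β}`. -/
def xi (β : ℝ) (f : (ι → ℝ) → ℝ → ℝ) (θ : ι → ℝ) (i : ι) : ℝ :=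
  ∫ x, score f θ x i * f θ x ^ (1 + β)

/-- `J_β(θ) = ∫ u_θ u_θᵀ f_θ^{1+β}`. -/
def matJ (β : ℝ) (f : (ι → ℝ) → ℝ → ℝ) (θ : ι → ℝ) : Matrix ι ι ℝ :=
  Matrix.of fun i j => ∫ x, score f θ x i * score f θ x j * f θ x ^ (1 + β)

/-- `K_β(θ) = ∫ u_θ u_θᵀ f_θ^{1+2β} - ξ ξᵀ`. -/
def matK (β : ℝ) (f : (ι → ℝ) → ℝ → ℝ) (θ : ι → ℝ) : Matrix ι ι ℝ :=
  Matrix.of fun i j =>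
    (∫ x, score f θ x i * score f θ x j * f θ x ^ (1 + 2 * β)) - xi β f θ i * xi β f θ j

/-- `A_γ(θ) = (1+γ) ∫ f_θ^{γ-1} (∂f_θ/∂θ_j) (∂f_θ/∂θ_i)`. -/
def matA (γ : ℝ) (f : (ι → ℝ) → ℝ → ℝ) (θ : ι → ℝ) : Matrix ι ι ℝ :=
  Matrix.of fun i j => (1 + γ) *
    ∫ x, f θ x ^ (γ - 1) * partialDeriv (fun θ' => f θ' x) θ j * partialDeriv (fun θ' => f θ' x) θ i

/-- `G(θ) = ∂gᵀ/∂θ`, for a null hypothesis `g(θ) = 0`. -/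
def matG (g : (ι → ℝ) → κ → ℝ) (θ : ι → ℝ) : Matrix ι κ ℝ :=
  Matrix.of fun i j => partialDeriv (fun θ' => g θ' j) θ i

/-- `B_β(θ) = J⁻¹ G (Gᵀ J⁻¹ G)⁻¹ Gᵀ J⁻¹`. -/
def matB (β : ℝ) (f : (ι → ℝ) → ℝ → ℝ) (g : (ι → ℝ) → κ → ℝ) (θ : ι → ℝ) : Matrix ι ι ℝ :=
  (matJ β f θ)⁻¹ * matG g θ * ((matG g θ).transpose * (matJ β f θ)⁻¹ * matG g θ)⁻¹ *
    (matG g θ).transpose * (matJ β f θ)⁻¹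

/-- The empirical objective function of the sample `x 0, …, x (n-1)`; for `β = 0` it is minus the
averaged log-likelihood. -/
def objective (β : ℝ) (f : (ι → ℝ) → ℝ → ℝ) (x : ℕ → ℝ) (n : ℕ) (θ : ι → ℝ) : ℝ :=
  if β = 0 then -(1 / (n : ℝ) * ∑ k ∈ Finset.range n, Real.log (f θ (x k)))
  else (∫ y, f θ y ^ (1 + β)) - (1 + 1 / β) * (1 / (n : ℝ) * ∑ k ∈ Finset.range n, f θ (x k) ^ β)

/-- The left-hand side of the estimating equation,
`n⁻¹ ∑ u_θ(x_k) f_θ(x_k)^β - ∫ u_θ f_θ^{1+β}`. -/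
def estimatingFun (β : ℝ) (f : (ι → ℝ) → ℝ → ℝ) (x : ℕ → ℝ) (n : ℕ) (θ : ι → ℝ) (i : ι) : ℝ :=
  1 / (n : ℝ) * ∑ k ∈ Finset.range n, score f θ (x k) i * f θ (x k) ^ β - xi β f θ i

variable {Ω : Type*} [MeasurableSpace Ω]

/-- With probability tending to one, `est n` minimizes the objective function over `S`
whenever the minimum over `S` is attained at all. -/
def IsMinimizing (P : Measure Ω) (β : ℝ) (f : (ι → ℝ) → ℝ → ℝ) (S : Set (ι → ℝ))
    (X : ℕ → Ω → ℝ) (est : ℕ → Ω → ι → ℝ) : Prop :=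
  Tendsto (fun n => P {ω |
    (∃ θ ∈ S, IsMinOn (objective β f (fun k => X k ω) n) S θ) ∧
    ¬ (est n ω ∈ S ∧ IsMinOn (objective β f (fun k => X k ω) n) S (est n ω))}) atTop (𝓝 0)

/-- The minimum density power divergence estimator over the parameter space `Θ`: a minimizer of
the objective function, or a sequence of roots (with probability tending to one) of the estimating
equation that is consistent for the true value `θ₀`. -/
def IsMDPDE (P : Measure Ω) (β : ℝ) (f : (ι → ℝ) → ℝ → ℝ) (Θ : Set (ι → ℝ)) (θ₀ : ι → ℝ)
    (X : ℕ → Ω → ℝ) (est : ℕ → Ω → ι → ℝ) : Prop :=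
  (∀ n, Measurable (est n)) ∧
  (IsMinimizing P β f Θ X est ∨
    (TendstoInMeasure P est atTop (fun _ => θ₀) ∧
      Tendsto (fun n => P {ω | ¬ (est n ω ∈ Θ ∧
        ∀ i, estimatingFun β f (fun k => X k ω) n (est n ω) i = 0)}) atTop (𝓝 0)))

/-- The restricted minimum density power divergence estimator under `g(θ) = 0`: a minimizer of
the objective function over `{θ ∈ Θ | g θ = 0}`, or a sequence of solutions (with probability
tending to one) of the Lagrange equations that is consistent for the true value `θ₀`. -/
def IsRMDPDE (P : Measure Ω) (β : ℝ) (f : (ι → ℝ) → ℝ → ℝ) (Θ : Set (ι → ℝ))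
    (g : (ι → ℝ) → κ → ℝ) (θ₀ : ι → ℝ) (X : ℕ → Ω → ℝ) (est : ℕ → Ω → ι → ℝ) : Prop :=
  (∀ n, Measurable (est n)) ∧
  (IsMinimizing P β f {θ ∈ Θ | g θ = 0} X est ∨
    (TendstoInMeasure P est atTop (fun _ => θ₀) ∧
      Tendsto (fun n => P {ω | ¬ (est n ω ∈ Θ ∧ g (est n ω) = 0 ∧ ∃ l : κ → ℝ, ∀ i,
        -((n : ℝ) * estimatingFun β f (fun k => X k ω) n (est n ω) i)
          + (matG g (est n ω)).mulVec l i = 0)}) atTop (𝓝 0)))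

/-- The density power divergence test statistic `T_γ = 2 n d_γ(f_{est}, f_{est₀})`. -/
def testStat (γ : ℝ) (f : (ι → ℝ) → ℝ → ℝ) (est est₀ : ℕ → Ω → ι → ℝ) (n : ℕ) (ω : Ω) : ℝ :=
  2 * (n : ℝ) * divergence γ (f (est n ω)) (f (est₀ n ω))

end Model

/-- The normal densities, with parameter `θ = (μ, σ)`. -/
def normalModel (θ : Fin 2 → ℝ) (x : ℝ) : ℝ :=
  gaussianPDFReal (θ 0) (Real.toNNReal (θ 1 ^ 2)) x

/-- The parameter space `μ ∈ ℝ`, `σ > 0`. -/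
def normalSpace : Set (Fin 2 → ℝ) := {θ | 0 < θ 1}

/-- The restriction function `g(μ, σ) = μ - μ₀`. -/
def normalNull (μ₀ : ℝ) (θ : Fin 2 → ℝ) : Fin 1 → ℝ := fun _ => θ 0 - μ₀

/-- `(β+1)³ / (σ^γ √(γ+1) (2β+1)^{3/2} (2π)^{γ/2})`. -/
def normalEigenvalue (σ β γ : ℝ) : ℝ :=
  1 / σ ^ γ * ((β + 1) ^ 3 /
    (Real.sqrt (γ + 1) * (2 * β + 1) ^ (3 / 2 : ℝ) * (2 * Real.pi) ^ (γ / 2)))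

end

end DPD

/-
Standardizing the observations with the true parameter `θ₀` turns the two estimating equations into
equations for the scale and location errors of the estimator. A first-order expansion together with
the law of large numbers linearizes them: each error is minus a score average divided by an
information constant, up to a relative error tending to zero in probability. Location and scale
scores decouple, so the restricted and unrestricted estimators of `σ` share their leading term,
whereas the location error of the restricted estimator vanishes. The closed form of the divergence
between two normal densities is quadratic in the location difference and of second order in the
scale ratio minus one, so `T_γ` is asymptotically a constant times the square of `√n` times the
location score average, and the central limit theorem applies. Minimizers of `Q_n` are consistent by
a compactness argument: the population gap is positive away from `θ₀`, also at infinity and at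
`σ = 0`, and finitely many neighbourhoods suffice.
-/

namespace DPD

noncomputable section

section ConvergenceInProbability

variable {Ω ι : Type*} [MeasurableSpace Ω] {P : Measure Ω} {l : Filter ι}

/-- The filter on `ι × Ω` of the families of events whose probability tends to one along `l`. It
turns convergence in probability and stochastic `o` and `O` relations into convergence and
asymptotic relations along a filter. -/
def inProb (P : Measure Ω) (l : Filter ι) : Filter (ι × Ω) where
  sets := {s | Tendsto (fun i => P {ω | (i, ω) ∉ s}) l (𝓝 0)}
  univ_sets := by simpa using tendsto_const_nhds
  sets_of_superset hs hst := tendsto_of_tendsto_of_tendsto_of_le_of_le tendsto_const_nhds hs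
    (fun _ => zero_le) fun _ => measure_mono fun _ hω h => hω (hst h)
  inter_sets {s t} hs ht := by
    have hst : Tendsto (fun i => P {ω | (i, ω) ∉ s} + P {ω | (i, ω) ∉ t}) l (𝓝 0) := by
      simpa using Tendsto.add hs ht
    refine tendsto_of_tendsto_of_tendsto_of_le_of_le tendsto_const_nhds hst (fun _ => zero_le)
      fun i => (measure_mono fun ω hω => ?_).trans (measure_union_le _ _)
    rwa [Set.mem_ofPred_eq, Set.mem_inter_iff, not_and_or] at hω

lemma eventually_inProb_iff {p : ι × Ω → Prop} :
    (∀ᶠ x in inProb P l, p x) ↔ Tendsto (fun i => P {ω | ¬ p (i, ω)}) l (𝓝 0) :=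
  Iff.rfl

lemma tendsto_fst_inProb : Tendsto Prod.fst (inProb P l) l := by
  intro s hs
  refine tendsto_const_nhds.congr' ?_
  filter_upwards [hs] with i hi
  simp [hi]

lemma tendsto_inProb_iff_tendstoInMeasure {E : Type*} [PseudoMetricSpace E] {Y : ι × Ω → E}
    {c : E} :
    Tendsto Y (inProb P l) (𝓝 c) ↔ TendstoInMeasure P (fun i ω => Y (i, ω)) l fun _ => c := by
  rw [tendstoInMeasure_iff_dist, Metric.tendsto_nhds]
  simp only [eventually_inProb_iff, not_lt, gt_iff_lt]

/-- By Markov's inequality a family bounded in `L¹` is bounded in probability. -/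
lemma tendsto_zero_of_isLittleO_of_integral_norm_le {E F : Type*} [NormedAddCommGroup E]
    [NormedAddCommGroup F] {Y : ι × Ω → E} {W : ι × Ω → F} {C : ℝ} (hYW : Y =o[inProb P l] W)
    (hW : ∀ i, Integrable (fun ω => W (i, ω)) P) (hC : ∀ i, ∫ ω, ‖W (i, ω)‖ ∂P ≤ C) :
    Tendsto Y (inProb P l) (𝓝 0) := by
  refine Metric.tendsto_nhds.2 fun ε hε => ?_
  rw [eventually_inProb_iff, ENNReal.tendsto_nhds_zero]
  intro η hη
  have hη2 : η / 2 ≠ 0 := (ENNReal.half_pos hη.ne').ne'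
  have hε0 : ENNReal.ofReal ε ≠ 0 := (ENNReal.ofReal_pos.2 hε).ne'
  obtain ⟨c, hc, hcC⟩ := ENNReal.exists_nnreal_pos_mul_lt (ENNReal.ofReal_ne_top (r := C))
    (mul_ne_zero hε0 hη2)
  have hsmall : ∀ i, P {ω | ENNReal.ofReal ε ≤ c * ‖W (i, ω)‖ₑ} ≤ η / 2 := fun i => by
    refine (ENNReal.mul_le_mul_iff_right hε0 ENNReal.ofReal_ne_top).1 ?_
    calc ENNReal.ofReal ε * P {ω | ENNReal.ofReal ε ≤ c * ‖W (i, ω)‖ₑ}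
        ≤ ∫⁻ ω, c * ‖W (i, ω)‖ₑ ∂P :=
          mul_meas_ge_le_lintegral₀ ((hW i).1.enorm.const_mul _) _
      _ = c * ENNReal.ofReal (∫ ω, ‖W (i, ω)‖ ∂P) := by
          rw [lintegral_const_mul' _ _ ENNReal.coe_ne_top,
            ofReal_integral_norm_eq_lintegral_enorm (hW i)]
      _ ≤ c * ENNReal.ofReal C := by gcongr; exact hC i
      _ ≤ ENNReal.ofReal ε * (η / 2) := hcC.le
  have hlarge := (ENNReal.tendsto_nhds_zero.1 (eventually_inProb_iff.1 (hYW.def hc)))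
    (η / 2) (pos_iff_ne_zero.2 hη2)
  filter_upwards [hlarge] with i hi
  refine (measure_mono fun ω hω => ?_).trans ((measure_union_le _ _).trans
    ((add_le_add hi (hsmall i)).trans_eq (ENNReal.add_halves η)))
  simp only [Set.mem_ofPred_eq, not_lt, dist_zero_right, Set.mem_union] at hω ⊢
  refine or_iff_not_imp_left.2 fun hle => ENNReal.ofReal_le_of_le_toReal ?_
  simpa using hω.trans (not_not.1 hle)

end ConvergenceInProbability

section SampleAverage

variable {α Ω : Type*}

/-- The average of `g` over the sample `x 0, …, x (n - 1)`, which is `0` for `n = 0`. -/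
def avg (x : ℕ → α) (n : ℕ) (g : α → ℝ) : ℝ := 1 / (n : ℝ) * ∑ k ∈ Finset.range n, g (x k)

lemma avg_add (x : ℕ → α) (n : ℕ) (g h : α → ℝ) :
    avg x n (fun z => g z + h z) = avg x n g + avg x n h := by
  simp only [avg, Finset.sum_add_distrib, mul_add]

lemma avg_sub (x : ℕ → α) (n : ℕ) (g h : α → ℝ) :
    avg x n (fun z => g z - h z) = avg x n g - avg x n h := by
  simp only [avg, Finset.sum_sub_distrib, mul_sub]

lemma avg_const_mul (x : ℕ → α) (n : ℕ) (c : ℝ) (g : α → ℝ) :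
    avg x n (fun z => c * g z) = c * avg x n g := by
  simp only [avg, ← Finset.mul_sum, mul_left_comm]

lemma avg_const (x : ℕ → α) {n : ℕ} (hn : n ≠ 0) (c : ℝ) : avg x n (fun _ => c) = c := by
  simp [avg, hn]

lemma avg_mono (x : ℕ → α) (n : ℕ) {g h : α → ℝ} (hgh : ∀ z, g z ≤ h z) :
    avg x n g ≤ avg x n h := by
  unfold avg
  gcongr
  exact hgh _

lemma abs_avg_le (x : ℕ → α) (n : ℕ) {g h : α → ℝ} (hgh : ∀ z, |g z| ≤ h z) :
    |avg x n g| ≤ avg x n h := by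
  unfold avg
  rw [abs_mul, abs_of_nonneg (by positivity : 0 ≤ 1 / (n : ℝ))]
  gcongr
  exact (Finset.abs_sum_le_sum_abs _ _).trans (Finset.sum_le_sum fun _ _ => hgh _)

variable [MeasurableSpace α] [MeasurableSpace Ω] {P : Measure Ω} {Z : ℕ → Ω → α} {ν : Measure α}

/-- `Z 0, Z 1, …` is a sequence of independent random variables with common distribution `ν`. -/
structure IsIIDSample (Z : ℕ → Ω → α) (ν : Measure α) (P : Measure Ω) : Prop where
  measurable : ∀ k, Measurable (Z k)
  iIndepFun : iIndepFun Z P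
  map_eq : ∀ k, P.map (Z k) = ν

namespace IsIIDSample

lemma comp {β : Type*} [MeasurableSpace β] (hZ : IsIIDSample Z ν P) {φ : α → β}
    (hφ : Measurable φ) : IsIIDSample (fun k ω => φ (Z k ω)) (ν.map φ) P where
  measurable k := hφ.comp (hZ.measurable k)
  iIndepFun := hZ.iIndepFun.comp (fun _ => φ) fun _ => hφ
  map_eq k := by rw [← hZ.map_eq k, Measure.map_map hφ (hZ.measurable k)]; rfl

variable {g : α → ℝ}

lemma integral_comp (hZ : IsIIDSample Z ν P) (hg : AEStronglyMeasurable g ν) (k : ℕ) :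
    ∫ ω, g (Z k ω) ∂P = ∫ z, g z ∂ν := by
  rw [← hZ.map_eq k] at hg ⊢
  exact (integral_map (hZ.measurable k).aemeasurable hg).symm

lemma integrable_comp (hZ : IsIIDSample Z ν P) (hg : Integrable g ν) (k : ℕ) :
    Integrable (fun ω => g (Z k ω)) P := by
  rw [← hZ.map_eq k] at hg
  exact hg.comp_measurable (hZ.measurable k)

lemma identDistrib (hZ : IsIIDSample Z ν P) (hg : Measurable g) (k : ℕ) :
    IdentDistrib (fun ω => g (Z k ω)) (fun ω => g (Z 0 ω)) P P where
  aemeasurable_fst := (hg.comp (hZ.measurable k)).aemeasurable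
  aemeasurable_snd := (hg.comp (hZ.measurable 0)).aemeasurable
  map_eq := ((hZ.comp hg).map_eq k).trans ((hZ.comp hg).map_eq 0).symm

lemma tendsto_avg [IsFiniteMeasure P] (hZ : IsIIDSample Z ν P) (hg : Measurable g)
    (hint : Integrable g ν) :
    Tendsto (fun p : ℕ × Ω => avg (fun k => Z k p.2) p.1 g) (inProb P atTop) (𝓝 (∫ z, g z ∂ν)) := by
  refine tendsto_inProb_iff_tendstoInMeasure.2 (tendstoInMeasure_of_tendsto_ae (fun n => ?_) ?_)
  · exact ((Finset.measurable_fun_sum (Finset.range n) fun k _ =>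
      hg.comp (hZ.measurable k)).const_mul (1 / (n : ℝ))).aestronglyMeasurable
  · have hslln := strong_law_ae_real (μ := P) (fun k ω => g (Z k ω)) (hZ.integrable_comp hint 0)
      (fun i j hij => (hZ.iIndepFun.indepFun hij).comp hg hg) (hZ.identDistrib hg)
    rw [hZ.integral_comp hint.aestronglyMeasurable 0] at hslln
    filter_upwards [hslln] with ω hω
    simpa [avg, div_eq_inv_mul] using hω

lemma memLp_comp (hZ : IsIIDSample Z ν P) (hg : MemLp g 2 ν) (k : ℕ) :
    MemLp (fun ω => g (Z k ω)) 2 P := by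
  rw [← hZ.map_eq k] at hg
  exact hg.comp_of_map (hZ.measurable k).aemeasurable

lemma memLp_avg (hZ : IsIIDSample Z ν P) (hg : MemLp g 2 ν) (n : ℕ) :
    MemLp (fun ω => avg (fun k => Z k ω) n g) 2 P :=
  (memLp_finsetSum _ fun k _ => hZ.memLp_comp hg k).const_mul _

lemma integral_avg_of_integral_eq_zero (hZ : IsIIDSample Z ν P) (hint : Integrable g ν)
    (h0 : ∫ z, g z ∂ν = 0) (n : ℕ) : ∫ ω, avg (fun k => Z k ω) n g ∂P = 0 := by
  simp only [avg]
  rw [integral_const_mul, integral_finsetSum _ fun k _ => hZ.integrable_comp hint k]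
  simp only [hZ.integral_comp hint.aestronglyMeasurable, h0, Finset.sum_const_zero, mul_zero]

lemma variance_avg (hZ : IsIIDSample Z ν P) (hg : Measurable g) (hgL2 : MemLp g 2 ν) (n : ℕ) :
    Var[fun ω => avg (fun k => Z k ω) n g; P] = Var[g; ν] / n := by
  have hvar : ∀ k, Var[fun ω => g (Z k ω); P] = Var[g; ν] := fun k => by
    rw [← hZ.map_eq k, variance_map hg.aemeasurable (hZ.measurable k).aemeasurable]; rfl
  have hsum := IndepFun.variance_sum (μ := P) (X := fun k ω => g (Z k ω)) (s := Finset.range n)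
    (fun k _ => hZ.memLp_comp hgL2 k) fun i _ j _ hij => (hZ.iIndepFun.indepFun hij).comp hg hg
  simp only [avg, variance_const_mul, hvar, Finset.sum_const, Finset.card_range] at hsum ⊢
  rw [← Finset.sum_fn, hsum]
  rcases eq_or_ne n 0 with rfl | hn
  · simp
  · rw [nsmul_eq_mul]
    field_simp

lemma mul_integral_avg_sq_le [IsFiniteMeasure P] (hZ : IsIIDSample Z ν P) (hg : Measurable g)
    (hgL2 : MemLp g 2 ν) (h0 : ∫ z, g z ∂ν = 0) (n : ℕ) :
    n * ∫ ω, avg (fun k => Z k ω) n g ^ 2 ∂P ≤ ∫ z, g z ^ 2 ∂ν := by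
  have : IsFiniteMeasure ν := hZ.map_eq 0 ▸ inferInstance
  rw [← variance_of_integral_eq_zero (hZ.memLp_avg hgL2 n).aestronglyMeasurable.aemeasurable
    (hZ.integral_avg_of_integral_eq_zero (hgL2.integrable one_le_two) h0 n),
    ← variance_of_integral_eq_zero hg.aemeasurable h0, hZ.variance_avg hg hgL2 n]
  rw [mul_div_left_comm]
  exact mul_le_of_le_one_right (variance_nonneg _ _) (div_self_le_one _)

lemma tendstoInDistribution_mul_avg_sq [IsProbabilityMeasure P] (hZ : IsIIDSample Z ν P)
    (hg : Measurable g) (hgL2 : MemLp g 2 ν) (h0 : ∫ z, g z ∂ν = 0) :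
    TendstoInDistribution (fun (n : ℕ) ω => n * avg (fun k => Z k ω) n g ^ 2) atTop
      (fun z : ℝ => (∫ y, g y ^ 2 ∂ν) * z ^ 2) (fun _ => P) (gaussianReal 0 1) := by
  set v : ℝ := ∫ y, g y ^ 2 ∂ν
  have hv0 : 0 ≤ v := integral_nonneg fun _ => sq_nonneg _
  have hmean : ∫ ω, g (Z 0 ω) ∂P = 0 := by
    rw [hZ.integral_comp hg.aestronglyMeasurable, h0]
  have hvar : Var[fun ω => g (Z 0 ω); P] = v := by
    rw [variance_of_integral_eq_zero (X := fun ω => g (Z 0 ω))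
      (hg.comp (hZ.measurable 0)).aemeasurable hmean]
    exact hZ.integral_comp (g := fun z => g z ^ 2) (hg.pow_const 2).aestronglyMeasurable 0
  have hlaw : HasLaw (fun z : ℝ => √v * z) (gaussianReal 0 v.toNNReal) (gaussianReal 0 1) := by
    have h := gaussianReal_const_mul (HasLaw.id (μ := gaussianReal 0 1)) √v
    convert! h using 2
    · simp
    · ext; simp [hv0]
  have hclt := tendstoInDistribution_inv_sqrt_mul_sum_sub (P := P)
    (X := fun k ω => g (Z k ω)) (hvar ▸ hlaw) (hZ.memLp_comp hgL2 0)
    (hZ.iIndepFun.comp (fun _ => g) fun _ => hg) (hZ.identDistrib hg)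
  have hsq := hclt.continuous_comp (continuous_pow 2)
  convert! hsq using 1
  · ext n ω
    rcases eq_or_ne n 0 with rfl | hn
    · simp
    · simp only [avg, Function.comp_apply, hmean, mul_zero, sub_zero, mul_pow, inv_pow,
        Real.sq_sqrt n.cast_nonneg]
      field_simp
  · ext z
    simp only [Function.comp_apply, mul_pow, hvar, Real.sq_sqrt hv0]

end IsIIDSample

end SampleAverage

section GaussianMoments

/-- The Gaussian weight `exp (-c z² / 2)`: powers of a normal density are multiples of it. -/
def gaussWeight (c z : ℝ) : ℝ := Real.exp (-(c * z ^ 2 / 2))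

lemma gaussWeight_pos (c z : ℝ) : 0 < gaussWeight c z := Real.exp_pos _

lemma gaussWeight_le_one {c : ℝ} (hc : 0 ≤ c) (z : ℝ) : gaussWeight c z ≤ 1 :=
  Real.exp_le_one_iff.2 (neg_nonpos.2 (by positivity))

@[simp]
lemma gaussWeight_zero_left (z : ℝ) : gaussWeight 0 z = 1 := by simp [gaussWeight]

lemma gaussWeight_mul (a b z : ℝ) : gaussWeight a z * gaussWeight b z = gaussWeight (a + b) z := by
  rw [gaussWeight, gaussWeight, gaussWeight, ← Real.exp_add]
  ring_nf

lemma gaussWeight_sq (c z : ℝ) : gaussWeight c z ^ 2 = gaussWeight (2 * c) z := by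
  rw [sq, gaussWeight_mul, two_mul]

lemma gaussWeight_rpow (c z q : ℝ) : gaussWeight c z ^ q = gaussWeight (c * q) z := by
  rw [gaussWeight, gaussWeight, ← Real.exp_mul]
  ring_nf

@[fun_prop]
lemma continuous_gaussWeight (c : ℝ) : Continuous (gaussWeight c) := by
  unfold gaussWeight
  fun_prop

lemma hasDerivAt_gaussWeight (c z : ℝ) :
    HasDerivAt (gaussWeight c) (-(c * z) * gaussWeight c z) z := by
  have h : HasDerivAt (fun z : ℝ => -(c * z ^ 2 / 2)) (-(c * z)) z :=
    ((((hasDerivAt_pow 2 z).const_mul c).div_const 2).neg).congr_deriv (by push_cast; ring)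
  exact h.exp.congr_deriv (mul_comm _ _)

lemma integrable_pow_mul_gaussWeight (k : ℕ) {c : ℝ} (hc : 0 < c) :
    Integrable fun z : ℝ => z ^ k * gaussWeight c z := by
  have hk : (-1 : ℝ) < k := by linarith [k.cast_nonneg (α := ℝ)]
  refine (integrable_rpow_mul_exp_neg_mul_sq (half_pos hc) hk).congr (ae_of_all _ fun z => ?_)
  simp only [Real.rpow_natCast, gaussWeight]
  ring_nf

lemma integral_gaussWeight (c : ℝ) : ∫ z, gaussWeight c z = √(2 * Real.pi) / √c := by
  rw [← Real.sqrt_div Real.two_pi_pos.le, mul_comm, ← div_div_eq_mul_div, ← integral_gaussian]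
  simp only [gaussWeight]
  ring_nf

lemma gaussianPDFReal_zero_one (z : ℝ) :
    gaussianPDFReal 0 1 z = (√(2 * Real.pi))⁻¹ * gaussWeight 1 z := by
  simp only [gaussianPDFReal, gaussWeight, NNReal.coe_one, mul_one, sub_zero, one_mul, neg_div]

lemma integral_stdGaussian (g : ℝ → ℝ) :
    ∫ z, g z ∂gaussianReal 0 1 = (√(2 * Real.pi))⁻¹ * ∫ z, g z * gaussWeight 1 z := by
  rw [integral_gaussianReal_eq_integral_smul one_ne_zero, ← integral_const_mul]
  refine integral_congr_ae (ae_of_all _ fun z => ?_)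
  simp only [gaussianPDFReal_zero_one, smul_eq_mul]
  ring

lemma integrable_stdGaussian {g : ℝ → ℝ} (hg : Integrable fun z => g z * gaussWeight 1 z) :
    Integrable g (gaussianReal 0 1) := by
  rw [gaussianReal_of_var_ne_zero _ one_ne_zero,
    integrable_withDensity_iff_integrable_smul₀' (measurable_gaussianPDF 0 1).aemeasurable
      (ae_of_all _ fun _ => gaussianPDF_lt_top)]
  refine (hg.const_mul (√(2 * Real.pi))⁻¹).congr (ae_of_all _ fun z => ?_)
  simp only [toReal_gaussianPDF, gaussianPDFReal_zero_one, smul_eq_mul]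
  ring

variable {β : ℝ}

lemma integrable_gaussWeight_comp {μ : Measure ℝ} [IsFiniteMeasure μ] {u : ℝ → ℝ} (hβ : 0 ≤ β)
    (hu : Measurable u) : Integrable (fun z => gaussWeight β (u z)) μ := by
  refine Integrable.of_bound (by fun_prop) 1 (ae_of_all _ fun z => ?_)
  rw [Real.norm_eq_abs, abs_of_pos (gaussWeight_pos _ _)]
  exact gaussWeight_le_one hβ _

lemma integral_gaussWeight_sub (hβ : 0 < 1 + β) (m : ℝ) :
    ∫ z, gaussWeight β (z - m) ∂gaussianReal 0 1 = gaussWeight (β / (1 + β)) m / √(1 + β) := by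
  have hsq : ∀ z, gaussWeight β (z - m) * gaussWeight 1 z =
      gaussWeight (β / (1 + β)) m * gaussWeight (1 + β) (z - β / (1 + β) * m) := fun z => by
    simp only [gaussWeight, ← Real.exp_add]
    congr 1
    field_simp
    ring
  have hpi : √(2 * Real.pi) ≠ 0 := (Real.sqrt_pos.2 Real.two_pi_pos).ne'
  simp only [integral_stdGaussian, hsq]
  rw [integral_const_mul, integral_sub_right_eq_self (gaussWeight (1 + β)), integral_gaussWeight]
  field_simp

lemma integrable_pow_mul_gaussWeight_stdGaussian (k : ℕ) (hβ : 0 < 1 + β) :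
    Integrable (fun z => z ^ k * gaussWeight β z) (gaussianReal 0 1) := by
  refine integrable_stdGaussian ?_
  simp only [mul_assoc, gaussWeight_mul, add_comm β]
  exact integrable_pow_mul_gaussWeight k hβ

/-- The `k`-th moment of the standard normal distribution weighted by `gaussWeight β`. -/
def gaussMoment (β : ℝ) (k : ℕ) : ℝ := ∫ z, z ^ k * gaussWeight β z ∂gaussianReal 0 1

lemma gaussMoment_zero (hβ : 0 < 1 + β) : gaussMoment β 0 = 1 / √(1 + β) := by
  simpa [gaussMoment, gaussWeight] using integral_gaussWeight_sub hβ 0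

lemma one_add_mul_gaussMoment_succ (hβ : 0 < 1 + β) (k : ℕ) :
    (1 + β) * gaussMoment β (k + 1) = k * gaussMoment β (k - 1) := by
  have hderiv : ∀ z : ℝ, HasDerivAt (fun z => z ^ k * gaussWeight (1 + β) z)
      (k * (z ^ (k - 1) * gaussWeight (1 + β) z) -
        (1 + β) * (z ^ (k + 1) * gaussWeight (1 + β) z)) z := fun z =>
    ((hasDerivAt_pow k z).mul (hasDerivAt_gaussWeight _ z)).congr_deriv (by ring)
  have hint := fun j => integrable_pow_mul_gaussWeight j hβ
  have hparts := integral_eq_zero_of_hasDerivAt_of_integrable hderiv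
    (((hint (k - 1)).const_mul _).sub ((hint (k + 1)).const_mul _)) (hint k)
  rw [integral_sub ((hint _).const_mul _) ((hint _).const_mul _), integral_const_mul,
    integral_const_mul, sub_eq_zero] at hparts
  simp only [gaussMoment, integral_stdGaussian, mul_assoc, gaussWeight_mul, add_comm β]
  rw [mul_left_comm, ← hparts, mul_left_comm]

lemma integrable_quartic_mul_gaussWeight (hβ : 0 < 1 + β) (a₀ a₁ a₂ a₃ a₄ : ℝ) :
    Integrable (fun z => (a₀ + a₁ * z + a₂ * z ^ 2 + a₃ * z ^ 3 + a₄ * z ^ 4) * gaussWeight β z)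
      (gaussianReal 0 1) := by
  have hint := fun k a => (integrable_pow_mul_gaussWeight_stdGaussian k hβ).const_mul a
  refine (((((hint 0 a₀).add (hint 1 a₁)).add (hint 2 a₂)).add (hint 3 a₃)).add
    (hint 4 a₄)).congr (ae_of_all _ fun z => ?_)
  simp only [Pi.add_apply]
  ring

lemma integral_quartic_mul_gaussWeight (hβ : 0 < 1 + β) (a₀ a₁ a₂ a₃ a₄ : ℝ) :
    ∫ z, (a₀ + a₁ * z + a₂ * z ^ 2 + a₃ * z ^ 3 + a₄ * z ^ 4) * gaussWeight β z ∂gaussianReal 0 1 =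
      (a₀ + a₂ / (1 + β) + 3 * a₄ / (1 + β) ^ 2) / √(1 + β) := by
  have hint := fun k a => (integrable_pow_mul_gaussWeight_stdGaussian k hβ).const_mul a
  have hsum : ∫ z, (a₀ + a₁ * z + a₂ * z ^ 2 + a₃ * z ^ 3 + a₄ * z ^ 4) * gaussWeight β z
      ∂gaussianReal 0 1 = a₀ * gaussMoment β 0 + a₁ * gaussMoment β 1 + a₂ * gaussMoment β 2 +
        a₃ * gaussMoment β 3 + a₄ * gaussMoment β 4 := by
    simp only [gaussMoment, ← integral_const_mul]
    rw [← integral_add (hint 0 a₀) (hint 1 a₁), ← integral_add _ (hint 2 a₂),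
      ← integral_add _ (hint 3 a₃), ← integral_add _ (hint 4 a₄)]
    · simp only [add_mul, pow_zero, pow_one, one_mul, mul_assoc]
    · exact (((hint 0 a₀).add (hint 1 a₁)).add (hint 2 a₂)).add (hint 3 a₃)
    · exact ((hint 0 a₀).add (hint 1 a₁)).add (hint 2 a₂)
    · exact (hint 0 a₀).add (hint 1 a₁)
  have hsucc := one_add_mul_gaussMoment_succ hβ
  have h1 : gaussMoment β 1 = 0 := by simpa [hβ.ne'] using hsucc 0
  have h2 : gaussMoment β 2 = gaussMoment β 0 / (1 + β) := by
    rw [eq_div_iff hβ.ne', mul_comm]; simpa using hsucc 1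
  have h3 : gaussMoment β 3 = 0 := by simpa [hβ.ne', h1] using hsucc 2
  have h4 : gaussMoment β 4 = 3 * gaussMoment β 0 / (1 + β) ^ 2 := by
    have : (1 + β) * gaussMoment β 4 = 3 * gaussMoment β 2 := by simpa using hsucc 3
    rw [h2] at this
    field_simp at this ⊢
    linarith
  rw [hsum, h1, h2, h3, h4, gaussMoment_zero hβ]
  ring

end GaussianMoments

section NormalModel

/-- The maximum value of a normal density with standard deviation `s`. -/
def normalPeak (s : ℝ) : ℝ := (√(2 * Real.pi) * s)⁻¹

lemma normalPeak_pos {s : ℝ} (hs : 0 < s) : 0 < normalPeak s := by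
  unfold normalPeak
  positivity

lemma normalPeak_rpow_eq_mul {s t : ℝ} (hs : 0 < s) (ht : 0 < t) (q : ℝ) :
    normalPeak s ^ q = normalPeak t ^ q * (t / s) ^ q := by
  rw [← Real.mul_rpow (normalPeak_pos ht).le (by positivity), normalPeak, normalPeak]
  congr 1
  field_simp

lemma hasDerivAt_normalPeak_rpow {s : ℝ} (hs : 0 < s) (q : ℝ) :
    HasDerivAt (fun s => normalPeak s ^ q) (-(q / s) * normalPeak s ^ q) s := by
  have hpeak : HasDerivAt normalPeak (-(normalPeak s / s)) s := by
    refine ((hasDerivAt_id s).const_mul √(2 * Real.pi)).inv (by positivity) |>.congr_deriv ?_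
    simp only [normalPeak, id_eq]
    field_simp
  refine (hpeak.rpow_const (p := q) (Or.inl (normalPeak_pos hs).ne')).congr_deriv ?_
  rw [Real.rpow_sub_one (normalPeak_pos hs).ne']
  field_simp [(normalPeak_pos hs).ne']

lemma gaussianReal_zero_one_map (m : ℝ) (s : ℝ) :
    (gaussianReal 0 1).map (fun z => m + s * z) = gaussianReal m (s ^ 2).toNNReal := by
  have hcomp := Measure.map_map (μ := gaussianReal 0 1) (measurable_const_add m)
    (measurable_const_mul s)
  rw [gaussianReal_map_const_mul, gaussianReal_map_const_add] at hcomp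
  rw [show (fun z => m + s * z) = (fun x => m + x) ∘ fun z => s * z from rfl, ← hcomp]
  congr 1
  · ring
  · ext
    simp [sq_nonneg]

lemma gaussianReal_map_standardize (m : ℝ) {s : ℝ} (hs : s ≠ 0) :
    (gaussianReal m (s ^ 2).toNNReal).map (fun x => (x - m) / s) = gaussianReal 0 1 := by
  rw [← gaussianReal_zero_one_map, Measure.map_map (by fun_prop) (by fun_prop)]
  have hid : (fun x => (x - m) / s) ∘ (fun z => m + s * z) = id := by
    ext z
    simp [hs]
  rw [hid, Measure.map_id]

variable {θ : Fin 2 → ℝ}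

lemma integral_mul_normalModel (hθ : 0 < θ 1) (G : ℝ → ℝ) :
    ∫ x, G x * normalModel θ x = ∫ z, G (θ 0 + θ 1 * z) ∂gaussianReal 0 1 := by
  have hv : (θ 1 ^ 2).toNNReal ≠ 0 := (Real.toNNReal_pos.2 (by positivity)).ne'
  have hemb : MeasurableEmbedding fun z => θ 0 + θ 1 * z :=
    ((Homeomorph.mulLeft₀ (θ 1) hθ.ne').trans (Homeomorph.addLeft (θ 0))).measurableEmbedding
  rw [← hemb.integral_map, gaussianReal_zero_one_map, integral_gaussianReal_eq_integral_smul hv]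
  simp only [normalModel, smul_eq_mul, mul_comm]

lemma normalModel_eq (hθ : 0 < θ 1) (x : ℝ) :
    normalModel θ x = normalPeak (θ 1) * gaussWeight 1 ((x - θ 0) / θ 1) := by
  rw [normalModel, gaussianPDFReal, Real.coe_toNNReal _ (sq_nonneg _),
    Real.sqrt_mul Real.two_pi_pos.le, Real.sqrt_sq hθ.le, normalPeak, gaussWeight]
  congr 2
  field_simp

lemma normalModel_pos (hθ : 0 < θ 1) (x : ℝ) : 0 < normalModel θ x := by
  rw [normalModel_eq hθ]
  exact mul_pos (normalPeak_pos hθ) (gaussWeight_pos _ _)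

lemma normalModel_rpow (hθ : 0 < θ 1) (x q : ℝ) :
    normalModel θ x ^ q = normalPeak (θ 1) ^ q * gaussWeight q ((x - θ 0) / θ 1) := by
  rw [normalModel_eq hθ, Real.mul_rpow (normalPeak_pos hθ).le (gaussWeight_pos _ _).le,
    gaussWeight_rpow, one_mul]

lemma log_normalModel (hθ : 0 < θ 1) (x : ℝ) :
    Real.log (normalModel θ x) = Real.log (normalPeak (θ 1)) - ((x - θ 0) / θ 1) ^ 2 / 2 := by
  rw [normalModel_eq hθ, Real.log_mul (normalPeak_pos hθ).ne' (gaussWeight_pos _ _).ne',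
    gaussWeight, Real.log_exp, one_mul, ← sub_eq_add_neg]

lemma integral_mul_normalModel_rpow (hθ : 0 < θ 1) (F : ℝ → ℝ) (β : ℝ) :
    ∫ x, F ((x - θ 0) / θ 1) * normalModel θ x ^ (1 + β) =
      normalPeak (θ 1) ^ β * ∫ z, F z * gaussWeight β z ∂gaussianReal 0 1 := by
  have hpow : ∀ x, F ((x - θ 0) / θ 1) * normalModel θ x ^ (1 + β) =
      F ((x - θ 0) / θ 1) * normalModel θ x ^ β * normalModel θ x := fun x => by
    rw [add_comm, Real.rpow_add_one (normalModel_pos hθ x).ne', mul_assoc]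
  simp only [hpow]
  rw [integral_mul_normalModel hθ fun x => F ((x - θ 0) / θ 1) * normalModel θ x ^ β,
    ← integral_const_mul]
  refine integral_congr_ae (ae_of_all _ fun z => ?_)
  simp only [normalModel_rpow hθ, add_sub_cancel_left, mul_div_cancel_left₀ z hθ.ne']
  ring

lemma integral_quartic_mul_normalModel_rpow (hθ : 0 < θ 1) {β : ℝ} (hβ : 0 < 1 + β) {F : ℝ → ℝ}
    (a₀ a₁ a₂ a₃ a₄ : ℝ)
    (hF : ∀ x, F x = a₀ + a₁ * ((x - θ 0) / θ 1) + a₂ * ((x - θ 0) / θ 1) ^ 2 +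
      a₃ * ((x - θ 0) / θ 1) ^ 3 + a₄ * ((x - θ 0) / θ 1) ^ 4) :
    ∫ x, F x * normalModel θ x ^ (1 + β) =
      normalPeak (θ 1) ^ β * ((a₀ + a₂ / (1 + β) + 3 * a₄ / (1 + β) ^ 2) / √(1 + β)) := by
  simp only [hF]
  rw [integral_mul_normalModel_rpow hθ
    (fun z => a₀ + a₁ * z + a₂ * z ^ 2 + a₃ * z ^ 3 + a₄ * z ^ 4) β,
    integral_quartic_mul_gaussWeight hβ]

lemma integral_normalModel_rpow (hθ : 0 < θ 1) {β : ℝ} (hβ : 0 < 1 + β) :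
    ∫ x, normalModel θ x ^ (1 + β) = normalPeak (θ 1) ^ β / √(1 + β) := by
  simpa [div_eq_mul_inv] using
    integral_quartic_mul_normalModel_rpow hθ hβ (F := fun _ => 1) 1 0 0 0 0 fun x => by ring

lemma update_one_pos (hθ : 0 < θ 1) (t : ℝ) : 0 < Function.update θ 0 t 1 := by
  simpa using hθ

lemma eventually_update_one_pos (hθ : 0 < θ 1) (i : Fin 2) :
    ∀ᶠ t in 𝓝 (θ i), 0 < Function.update θ i t 1 := by
  fin_cases i
  · exact Eventually.of_forall (update_one_pos hθ)
  · filter_upwards [lt_mem_nhds hθ] with t ht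
    simpa using ht

lemma hasDerivAt_log_normalModel_loc (hθ : 0 < θ 1) (x : ℝ) :
    HasDerivAt (fun t => Real.log (normalModel (Function.update θ 0 t) x))
      ((x - θ 0) / θ 1 / θ 1) (θ 0) := by
  have hlog : ∀ t, Real.log (normalModel (Function.update θ 0 t) x) =
      Real.log (normalPeak (θ 1)) - ((x - t) / θ 1) ^ 2 / 2 := fun t => by
    rw [log_normalModel (update_one_pos hθ t), Function.update_self,
      Function.update_of_ne one_ne_zero]
  simp only [hlog]
  refine (((((hasDerivAt_id (θ 0)).const_sub x).div_const (θ 1)).pow 2).div_const 2).const_sub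
    _ |>.congr_deriv ?_
  simp only [id_eq]
  ring

lemma hasDerivAt_log_normalModel_scale (hθ : 0 < θ 1) (x : ℝ) :
    HasDerivAt (fun t => Real.log (normalModel (Function.update θ 1 t) x))
      ((((x - θ 0) / θ 1) ^ 2 - 1) / θ 1) (θ 1) := by
  have hlog : (fun t => Real.log (normalModel (Function.update θ 1 t) x)) =ᶠ[𝓝 (θ 1)]
      fun t => -(Real.log √(2 * Real.pi) + Real.log t) - ((x - θ 0) * t⁻¹) ^ 2 / 2 := by
    filter_upwards [lt_mem_nhds hθ] with t ht
    rw [log_normalModel (by simpa using ht), Function.update_self,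
      Function.update_of_ne zero_ne_one, normalPeak, Real.log_inv,
      Real.log_mul (by positivity) ht.ne', div_eq_mul_inv (x - θ 0)]
  refine (((Real.hasDerivAt_log hθ.ne').const_add _).neg.sub
    ((((hasDerivAt_inv hθ.ne').const_mul (x - θ 0)).pow 2).div_const 2)).congr_deriv ?_
    |>.congr_of_eventuallyEq hlog
  push_cast
  field_simp
  ring

lemma score_normalModel_loc (hθ : 0 < θ 1) (x : ℝ) :
    score normalModel θ x 0 = (x - θ 0) / θ 1 / θ 1 :=
  (hasDerivAt_log_normalModel_loc hθ x).deriv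

lemma score_normalModel_scale (hθ : 0 < θ 1) (x : ℝ) :
    score normalModel θ x 1 = (((x - θ 0) / θ 1) ^ 2 - 1) / θ 1 :=
  (hasDerivAt_log_normalModel_scale hθ x).deriv

lemma hasDerivAt_log_normalModel (hθ : 0 < θ 1) (x : ℝ) (i : Fin 2) :
    HasDerivAt (fun t => Real.log (normalModel (Function.update θ i t) x))
      (score normalModel θ x i) (θ i) := by
  fin_cases i
  · exact (hasDerivAt_log_normalModel_loc hθ x).differentiableAt.hasDerivAt
  · exact (hasDerivAt_log_normalModel_scale hθ x).differentiableAt.hasDerivAt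

lemma hasDerivAt_normalModel_rpow (hθ : 0 < θ 1) (x q : ℝ) (i : Fin 2) :
    HasDerivAt (fun t => normalModel (Function.update θ i t) x ^ q)
      (q * (score normalModel θ x i * normalModel θ x ^ q)) (θ i) := by
  have hexp : (fun t => normalModel (Function.update θ i t) x ^ q) =ᶠ[𝓝 (θ i)]
      fun t => Real.exp (q * Real.log (normalModel (Function.update θ i t) x)) := by
    filter_upwards [eventually_update_one_pos hθ i] with t ht
    rw [Real.rpow_def_of_pos (normalModel_pos ht x), mul_comm]
  refine ((hasDerivAt_log_normalModel hθ x i).const_mul q).exp.congr_deriv ?_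
    |>.congr_of_eventuallyEq hexp
  rw [Function.update_eq_self, mul_comm q (Real.log _),
    ← Real.rpow_def_of_pos (normalModel_pos hθ x)]
  ring

lemma partialDeriv_normalModel (hθ : 0 < θ 1) (x : ℝ) (i : Fin 2) :
    partialDeriv (fun θ' => normalModel θ' x) θ i = score normalModel θ x i * normalModel θ x := by
  simpa only [partialDeriv, Real.rpow_one, one_mul] using
    (hasDerivAt_normalModel_rpow hθ x 1 i).deriv

end NormalModel

section Matrices

variable {θ : Fin 2 → ℝ} {β γ μ₀ σ : ℝ}

/-- The location entry of the matrix `J_β` of the standardized model: `J_β(μ, σ)` is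
`diag (locInfo β, scaleInfo β)` up to the factor `normalPeak σ ^ β / σ ^ 2`. -/
def locInfo (β : ℝ) : ℝ := 1 / (1 + β) / √(1 + β)

/-- The scale entry of the matrix `J_β` of the standardized model, see `locInfo`. -/
def scaleInfo (β : ℝ) : ℝ := (2 + β ^ 2) / (1 + β) ^ 2 / √(1 + β)

lemma locInfo_pos (hβ : 0 < 1 + β) : 0 < locInfo β := by
  unfold locInfo
  positivity

lemma scaleInfo_pos (hβ : 0 < 1 + β) : 0 < scaleInfo β := by
  unfold scaleInfo
  positivity

lemma xi_normalModel_loc (hθ : 0 < θ 1) (hβ : 0 < 1 + β) : xi β normalModel θ 0 = 0 := by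
  rw [xi, integral_quartic_mul_normalModel_rpow hθ hβ 0 (1 / θ 1) 0 0 0 fun x => by
    rw [score_normalModel_loc hθ]; ring]
  simp

lemma xi_normalModel_scale (hθ : 0 < θ 1) (hβ : 0 < 1 + β) :
    xi β normalModel θ 1 = -(normalPeak (θ 1) ^ β / θ 1 * (β / (1 + β) / √(1 + β))) := by
  rw [xi, integral_quartic_mul_normalModel_rpow hθ hβ (-1 / θ 1) 0 (1 / θ 1) 0 0 fun x => by
    rw [score_normalModel_scale hθ]; ring]
  field_simp
  ring

lemma matJ_normalModel (hθ : 0 < θ 1) (hβ : 0 < 1 + β) :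
    matJ β normalModel θ =
      Matrix.diagonal ((normalPeak (θ 1) ^ β / θ 1 ^ 2) • ![locInfo β, scaleInfo β]) := by
  ext i j
  fin_cases i <;> fin_cases j <;>
    simp only [matJ, Matrix.of_apply, Fin.zero_eta, Fin.mk_one, score_normalModel_loc hθ,
      score_normalModel_scale hθ, locInfo, scaleInfo, Matrix.diagonal_apply_eq, Pi.smul_apply,
      smul_eq_mul, Matrix.cons_val_zero, Matrix.cons_val_one]
  · rw [integral_quartic_mul_normalModel_rpow hθ hβ 0 0 (1 / θ 1 ^ 2) 0 0 fun x => by ring]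
    field_simp
    ring
  · rw [integral_quartic_mul_normalModel_rpow hθ hβ 0 (-1 / θ 1 ^ 2) 0 (1 / θ 1 ^ 2) 0
      fun x => by ring]
    simp
  · rw [integral_quartic_mul_normalModel_rpow hθ hβ 0 (-1 / θ 1 ^ 2) 0 (1 / θ 1 ^ 2) 0
      fun x => by ring]
    simp
  · rw [integral_quartic_mul_normalModel_rpow hθ hβ (1 / θ 1 ^ 2) 0 (-2 / θ 1 ^ 2) 0
      (1 / θ 1 ^ 2) fun x => by ring]
    field_simp
    ring

lemma matA_normalModel (hθ : 0 < θ 1) (γ : ℝ) :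
    matA γ normalModel θ = (1 + γ) • matJ γ normalModel θ := by
  ext i j
  simp only [matA, matJ, Matrix.of_apply, Matrix.smul_apply, smul_eq_mul,
    partialDeriv_normalModel hθ]
  congr 2
  ext x
  have hpow : normalModel θ x ^ (1 + γ) = normalModel θ x ^ (γ - 1) * normalModel θ x ^ 2 := by
    rw [← Real.rpow_natCast, ← Real.rpow_add (normalModel_pos hθ x)]
    congr 1
    push_cast
    ring
  rw [hpow]
  ring

lemma matK_eq (β : ℝ) (f : (Fin 2 → ℝ) → ℝ → ℝ) (θ : Fin 2 → ℝ) :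
    matK β f θ = matJ (2 * β) f θ - Matrix.vecMulVec (xi β f θ) (xi β f θ) :=
  rfl

lemma matG_normalNull (μ₀ : ℝ) (θ : Fin 2 → ℝ) : matG (normalNull μ₀) θ = !![1; 0] := by
  ext i j
  fin_cases i <;> simp [matG, partialDeriv, normalNull]

lemma matB_normalNull_of_matJ_eq_diagonal {f : (Fin 2 → ℝ) → ℝ → ℝ} {a b : ℝ} (ha : a ≠ 0)
    (hb : b ≠ 0) (hJ : matJ β f θ = Matrix.diagonal ![a, b]) :
    matB β f (normalNull μ₀) θ = Matrix.diagonal ![a⁻¹, 0] := by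
  have hinv : (matJ β f θ)⁻¹ = !![a⁻¹, 0; 0, b⁻¹] := by
    refine Matrix.inv_eq_right_inv ?_
    ext i j
    fin_cases i <;> fin_cases j <;> simp [hJ, ha, hb]
  have hmid : (Matrix.transpose !![(1 : ℝ); 0] * !![a⁻¹, 0; 0, b⁻¹] * !![(1 : ℝ); 0])⁻¹ =
      !![a] := by
    refine Matrix.inv_eq_right_inv ?_
    ext i j
    fin_cases i; fin_cases j
    simp [Matrix.mul_apply, Fin.sum_univ_two, ha]
  rw [matB, matG_normalNull, hinv, hmid]
  ext i j
  fin_cases i <;> fin_cases j <;>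
    simp [Matrix.mul_apply, Matrix.vecMul, dotProduct, Fin.sum_univ_two, ha]

lemma normalEigenvalue_eq (hσ : 0 < σ) (hβ : 0 ≤ β) (hγ : 0 ≤ γ) :
    normalEigenvalue σ β γ =
      normalPeak σ ^ γ / √(1 + γ) * (locInfo (2 * β) / locInfo β ^ 2) := by
  have hpeak : normalPeak σ ^ γ = 1 / σ ^ γ / (2 * Real.pi) ^ (γ / 2) := by
    rw [normalPeak, Real.inv_rpow (by positivity), Real.mul_rpow (by positivity) hσ.le,
      Real.sqrt_eq_rpow, ← Real.rpow_mul (by positivity), one_div_mul_eq_div]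
    field_simp
  have hpow : (2 * β + 1) ^ (3 / 2 : ℝ) = (2 * β + 1) * √(2 * β + 1) := by
    rw [show (3 / 2 : ℝ) = 1 + 1 / 2 by norm_num, Real.rpow_add (by positivity), Real.rpow_one,
      ← Real.sqrt_eq_rpow]
  have hsq := Real.sq_sqrt (show 0 ≤ 1 + β by positivity)
  rw [normalEigenvalue, hpow, hpeak, locInfo, locInfo, add_comm γ, add_comm (2 * β), add_comm β]
  field_simp
  rw [hsq]

lemma normalEigenvalue_pos (hσ : 0 < σ) (hβ : 0 ≤ β) (hγ : 0 ≤ γ) :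
    0 < normalEigenvalue σ β γ := by
  unfold normalEigenvalue
  positivity

lemma normalEigenvalue_zero_zero (σ : ℝ) : normalEigenvalue σ 0 0 = 1 := by
  simp [normalEigenvalue]

lemma matA_mul_matB_mul_matK_mul_matB (hσ : 0 < σ) (hβ : 0 ≤ β) (hγ : 0 ≤ γ) :
    matA γ normalModel ![μ₀, σ] * matB β normalModel (normalNull μ₀) ![μ₀, σ] *
        matK β normalModel ![μ₀, σ] * matB β normalModel (normalNull μ₀) ![μ₀, σ] =
      !![normalEigenvalue σ β γ, 0; 0, 0] := by
  have hθ : 0 < (![μ₀, σ] : Fin 2 → ℝ) 1 := hσ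
  have hβ' : 0 < 1 + β := by positivity
  have hpeak : 0 < normalPeak σ := normalPeak_pos hσ
  have hL := locInfo_pos hβ'
  have hS := scaleInfo_pos hβ'
  have hB := matB_normalNull_of_matJ_eq_diagonal (β := β) (f := normalModel) (θ := ![μ₀, σ])
    (a := normalPeak σ ^ β / σ ^ 2 * locInfo β) (b := normalPeak σ ^ β / σ ^ 2 * scaleInfo β)
    (μ₀ := μ₀) (by positivity) (by positivity) (by rw [matJ_normalModel hθ hβ']; simp)
  have hpow : normalPeak σ ^ (2 * β) = (normalPeak σ ^ β) ^ 2 := by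
    rw [← Real.rpow_natCast, ← Real.rpow_mul hpeak.le, mul_comm]
    norm_num
  rw [matA_normalModel hθ, matK_eq, hB, matJ_normalModel hθ (by positivity : 0 < 1 + γ),
    matJ_normalModel hθ (by positivity : 0 < 1 + 2 * β), normalEigenvalue_eq hσ hβ hγ]
  have hentry : normalPeak σ ^ γ / √(1 + γ) * (locInfo (2 * β) / locInfo β ^ 2) =
      (1 + γ) * (normalPeak σ ^ γ / σ ^ 2 * locInfo γ) * (normalPeak σ ^ β / σ ^ 2 * locInfo β)⁻¹ *
        (normalPeak σ ^ (2 * β) / σ ^ 2 * locInfo (2 * β)) *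
        (normalPeak σ ^ β / σ ^ 2 * locInfo β)⁻¹ := by
    have := Real.rpow_pos_of_pos hpeak β
    rw [hpow, locInfo.eq_1 γ]
    field_simp
  rw [hentry]
  ext i j
  fin_cases i <;> fin_cases j <;>
    simp [Matrix.mul_apply, Matrix.vecMulVec_apply, xi_normalModel_loc hθ hβ', mul_assoc]

lemma hasEigenvalue_toLin'_single_iff {a r : ℝ} (ha : a ≠ 0) (hr : r ≠ 0) :
    Module.End.HasEigenvalue (Matrix.toLin' !![a, 0; 0, 0]) r ↔ r = a := by
  have happly : ∀ v : Fin 2 → ℝ, Matrix.toLin' !![a, 0; 0, 0] v = ![a * v 0, 0] := fun v => by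
    ext i
    fin_cases i <;> simp [Matrix.toLin'_apply, Matrix.mulVec, dotProduct]
  constructor
  · intro h
    obtain ⟨v, hv⟩ := h.exists_hasEigenvector
    have hva := (happly v).symm.trans hv.apply_eq_smul
    have hv1 : v 1 = 0 := by simpa [hr] using congrFun hva 1
    have hv0 : v 0 ≠ 0 := fun h0 => hv.2 (by ext i; fin_cases i <;> simp [h0, hv1])
    exact (mul_right_cancel₀ hv0 (congrFun hva 0)).symm
  · rintro rfl
    refine Module.End.hasEigenvalue_of_hasEigenvector (x := ![1, 0]) ⟨?_, fun h => ?_⟩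
    · rw [Module.End.mem_eigenspace_iff, happly]
      ext i
      fin_cases i <;> simp
    · simpa using congrFun h 0

end Matrices

section EstimatingEquations

variable {θ : Fin 2 → ℝ} {β : ℝ}

/-- The standardized location component of the estimating function: up to a positive factor, the
location equation says that the average of `locScore β` over the standardized sample is zero. -/
def locScore (β z : ℝ) : ℝ := z * gaussWeight β z

/-- The standardized scale component of the estimating function, see `locScore`. The constant
centers it under the standard normal law. -/
def scaleScore (β z : ℝ) : ℝ := (z ^ 2 - 1) * gaussWeight β z + β / (1 + β) / √(1 + β)

lemma estimatingFun_loc (hθ : 0 < θ 1) (hβ : 0 < 1 + β) (x : ℕ → ℝ) (n : ℕ) :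
    estimatingFun β normalModel x n θ 0 =
      normalPeak (θ 1) ^ β / θ 1 * avg x n (fun y => locScore β ((y - θ 0) / θ 1)) := by
  rw [estimatingFun, xi_normalModel_loc hθ hβ, sub_zero, ← avg_const_mul, avg]
  refine congrArg _ (Finset.sum_congr rfl fun k _ => ?_)
  rw [score_normalModel_loc hθ, normalModel_rpow hθ, locScore]
  ring

lemma estimatingFun_scale (hθ : 0 < θ 1) (hβ : 0 < 1 + β) (x : ℕ → ℝ) {n : ℕ} (hn : n ≠ 0) :
    estimatingFun β normalModel x n θ 1 =
      normalPeak (θ 1) ^ β / θ 1 * avg x n (fun y => scaleScore β ((y - θ 0) / θ 1)) := by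
  simp only [scaleScore]
  rw [avg_add, avg_const x hn, mul_add, ← avg_const_mul, estimatingFun,
    xi_normalModel_scale hθ hβ, sub_neg_eq_add, avg]
  refine congrArg₂ _ (congrArg _ (Finset.sum_congr rfl fun k _ => ?_)) rfl
  rw [score_normalModel_scale hθ, normalModel_rpow hθ]
  ring

lemma estimatingFun_loc_eq_zero_iff (hθ : 0 < θ 1) (hβ : 0 < 1 + β) (x : ℕ → ℝ) (n : ℕ) :
    estimatingFun β normalModel x n θ 0 = 0 ↔
      avg x n (fun y => locScore β ((y - θ 0) / θ 1)) = 0 := by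
  have := normalPeak_pos hθ
  rw [estimatingFun_loc hθ hβ]
  exact mul_eq_zero_iff_left (by positivity)

lemma estimatingFun_scale_eq_zero_iff (hθ : 0 < θ 1) (hβ : 0 < 1 + β) (x : ℕ → ℝ) {n : ℕ}
    (hn : n ≠ 0) :
    estimatingFun β normalModel x n θ 1 = 0 ↔
      avg x n (fun y => scaleScore β ((y - θ 0) / θ 1)) = 0 := by
  have := normalPeak_pos hθ
  rw [estimatingFun_scale hθ hβ x hn]
  exact mul_eq_zero_iff_left (by positivity)

lemma objective_normalModel (hθ : 0 < θ 1) (hβ : 0 < 1 + β) (hβ₀ : β ≠ 0) (x : ℕ → ℝ) (n : ℕ) :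
    objective β normalModel x n θ = normalPeak (θ 1) ^ β *
      (1 / √(1 + β) - (1 + 1 / β) * avg x n (fun y => gaussWeight β ((y - θ 0) / θ 1))) := by
  rw [objective, if_neg hβ₀, integral_normalModel_rpow hθ hβ, avg]
  simp only [normalModel_rpow hθ, ← Finset.mul_sum]
  ring

lemma objective_zero_normalModel (hθ : 0 < θ 1) (x : ℕ → ℝ) (n : ℕ) :
    objective 0 normalModel x n θ =
      -avg x n (fun y => Real.log (normalPeak (θ 1)) - ((y - θ 0) / θ 1) ^ 2 / 2) := by
  simp only [objective, if_true, log_normalModel hθ, avg]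

lemma continuousOn_objective (hβ : 0 < 1 + β) (x : ℕ → ℝ) (n : ℕ) :
    ContinuousOn (objective β normalModel x n) normalSpace := by
  have hpeak : ContinuousOn (fun θ : Fin 2 → ℝ => normalPeak (θ 1)) normalSpace :=
    ContinuousOn.inv₀ (by fun_prop) fun θ (hθ : 0 < θ 1) => by positivity
  have hstd : ∀ y : ℝ, ContinuousOn (fun θ : Fin 2 → ℝ => (y - θ 0) / θ 1) normalSpace := fun y =>
    ContinuousOn.div (by fun_prop) (by fun_prop) fun θ hθ => ne_of_gt hθ
  have hpeak_ne : ∀ θ ∈ normalSpace, normalPeak (θ 1) ≠ 0 := fun θ hθ => (normalPeak_pos hθ).ne'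
  have havg : ∀ F : (Fin 2 → ℝ) → ℝ → ℝ, (∀ y, ContinuousOn (F · y) normalSpace) →
      ContinuousOn (fun θ => avg x n (F θ)) normalSpace := fun F hF =>
    continuousOn_const.mul (continuousOn_finsetSum _ fun k _ => hF (x k))
  rcases eq_or_ne β 0 with rfl | hβ₀
  · exact (havg _ fun y => (hpeak.log hpeak_ne).sub (((hstd y).pow 2).div_const 2)).neg.congr
      fun θ hθ => objective_zero_normalModel hθ x n
  · refine ContinuousOn.congr ?_ fun θ hθ => objective_normalModel hθ hβ hβ₀ x n
    exact (hpeak.rpow_const fun θ hθ => Or.inl (hpeak_ne θ hθ)).mul (continuousOn_const.sub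
      (continuousOn_const.mul (havg _ fun y =>
        (continuous_gaussWeight β).comp_continuousOn (hstd y))))

lemma hasDerivAt_integral_normalModel_rpow (hθ : 0 < θ 1) (hβ : 0 < 1 + β) (i : Fin 2) :
    HasDerivAt (fun t => ∫ y, normalModel (Function.update θ i t) y ^ (1 + β))
      ((1 + β) * xi β normalModel θ i) (θ i) := by
  have hclosed : (fun t => ∫ y, normalModel (Function.update θ i t) y ^ (1 + β)) =ᶠ[𝓝 (θ i)]
      fun t => normalPeak (Function.update θ i t 1) ^ β / √(1 + β) := by
    filter_upwards [eventually_update_one_pos hθ i] with t ht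
    exact integral_normalModel_rpow ht hβ
  refine HasDerivAt.congr_of_eventuallyEq ?_ hclosed
  fin_cases i
  · simpa [xi_normalModel_loc hθ hβ] using hasDerivAt_const _ _
  · simp only [Fin.mk_one, xi_normalModel_scale hθ hβ, Function.update_self]
    refine ((hasDerivAt_normalPeak_rpow hθ β).div_const √(1 + β)).congr_deriv ?_
    field_simp

lemma xi_zero_normalModel (hθ : 0 < θ 1) (i : Fin 2) : xi 0 normalModel θ i = 0 := by
  fin_cases i
  · exact xi_normalModel_loc hθ (by norm_num)
  · simpa using xi_normalModel_scale hθ (β := 0) (by norm_num)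

lemma hasDerivAt_objective (hθ : 0 < θ 1) (hβ : 0 < 1 + β) (x : ℕ → ℝ) (n : ℕ) (i : Fin 2) :
    HasDerivAt (fun t => objective β normalModel x n (Function.update θ i t))
      (-(1 + β) * estimatingFun β normalModel x n θ i) (θ i) := by
  rcases eq_or_ne β 0 with rfl | hβ₀
  · simp only [objective, if_true]
    refine ((HasDerivAt.fun_sum (u := Finset.range n) fun k _ =>
      hasDerivAt_log_normalModel hθ (x k) i).const_mul (1 / (n : ℝ))).neg.congr_deriv ?_
    simp [estimatingFun, xi_zero_normalModel hθ]
  · simp only [objective, if_neg hβ₀]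
    refine ((hasDerivAt_integral_normalModel_rpow hθ hβ i).sub
      (((HasDerivAt.fun_sum (u := Finset.range n) fun k _ =>
        hasDerivAt_normalModel_rpow hθ (x k) β i).const_mul (1 / (n : ℝ))).const_mul
          (1 + 1 / β))).congr_deriv ?_
    rw [← Finset.mul_sum, estimatingFun]
    field_simp
    ring

lemma estimatingFun_eq_zero_of_isMinOn (hθ : 0 < θ 1) (hβ : 0 < 1 + β) {x : ℕ → ℝ} {n : ℕ}
    {S : Set (Fin 2 → ℝ)} (hmin : IsMinOn (objective β normalModel x n) S θ) (i : Fin 2)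
    (hS : ∀ᶠ t in 𝓝 (θ i), Function.update θ i t ∈ S) :
    estimatingFun β normalModel x n θ i = 0 := by
  have hloc : IsLocalMin (fun t => objective β normalModel x n (Function.update θ i t)) (θ i) := by
    filter_upwards [hS] with t ht
    simpa using hmin ht
  have hderiv := hloc.hasDerivAt_eq_zero (hasDerivAt_objective hθ hβ x n i)
  exact (mul_eq_zero.1 hderiv).resolve_left (neg_ne_zero.2 hβ.ne')

end EstimatingEquations

section Divergence

variable {θ θ' : Fin 2 → ℝ} {γ : ℝ}

lemma integral_gaussWeight_add_mul {δ r : ℝ} (hr : r ≠ 0) (hγ : 0 < 1 + γ * r ^ 2) :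
    ∫ z, gaussWeight γ (δ + r * z) ∂gaussianReal 0 1 =
      gaussWeight (γ / (1 + γ * r ^ 2)) δ / √(1 + γ * r ^ 2) := by
  have hscale : ∀ z, gaussWeight γ (δ + r * z) = gaussWeight (γ * r ^ 2) (z - -(δ / r)) :=
    fun z => by
      rw [gaussWeight, gaussWeight]
      congr 1
      field_simp
      ring
  simp only [hscale]
  rw [integral_gaussWeight_sub hγ, gaussWeight, gaussWeight]
  congr 2
  field_simp

lemma integral_normalModel_rpow_mul (hθ : 0 < θ 1) (hθ' : 0 < θ' 1)
    (hγ : 0 < 1 + γ * (θ 1 / θ' 1) ^ 2) :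
    ∫ x, normalModel θ' x ^ γ * normalModel θ x = normalPeak (θ' 1) ^ γ *
      (gaussWeight (γ / (1 + γ * (θ 1 / θ' 1) ^ 2)) ((θ 0 - θ' 0) / θ' 1) /
        √(1 + γ * (θ 1 / θ' 1) ^ 2)) := by
  rw [integral_mul_normalModel hθ]
  simp only [normalModel_rpow hθ']
  rw [integral_const_mul, ← integral_gaussWeight_add_mul (div_pos hθ hθ').ne' hγ]
  congr! 4
  field_simp
  ring

lemma integrable_normalModel_rpow (hθ : 0 < θ 1) {β : ℝ} (hβ : 0 < 1 + β) :
    Integrable fun x => normalModel θ x ^ (1 + β) := by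
  have := normalPeak_pos hθ
  refine not_imp_comm.1 integral_undef ?_
  rw [integral_normalModel_rpow hθ hβ]
  positivity

lemma integrable_normalModel_rpow_mul (hθ : 0 < θ 1) (hθ' : 0 < θ' 1)
    (hγ : 0 < 1 + γ * (θ 1 / θ' 1) ^ 2) :
    Integrable fun x => normalModel θ' x ^ γ * normalModel θ x := by
  have := normalPeak_pos hθ'
  have := gaussWeight_pos (γ / (1 + γ * (θ 1 / θ' 1) ^ 2)) ((θ 0 - θ' 0) / θ' 1)
  refine not_imp_comm.1 integral_undef ?_
  rw [integral_normalModel_rpow_mul hθ hθ' hγ]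
  positivity

lemma divergence_normalModel (hθ : 0 < θ 1) (hθ' : 0 < θ' 1) (hγ : 0 < γ) :
    divergence γ (normalModel θ) (normalModel θ') = normalPeak (θ' 1) ^ γ *
      ((1 + 1 / γ * (θ 1 / θ' 1) ^ (-γ)) / √(1 + γ) - (1 + 1 / γ) *
        (gaussWeight (γ / (1 + γ * (θ 1 / θ' 1) ^ 2)) ((θ 0 - θ' 0) / θ' 1) /
          √(1 + γ * (θ 1 / θ' 1) ^ 2))) := by
  have hγ₁ : 0 < 1 + γ := by linarith
  have hγr : 0 < 1 + γ * (θ 1 / θ' 1) ^ 2 := by positivity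
  have hpeak : normalPeak (θ 1) ^ γ = normalPeak (θ' 1) ^ γ * (θ 1 / θ' 1) ^ (-γ) := by
    rw [normalPeak_rpow_eq_mul hθ hθ', Real.rpow_neg (by positivity),
      ← Real.inv_rpow (by positivity), inv_div]
  have hcross := integrable_normalModel_rpow_mul hθ hθ' hγr
  have hself := integrable_normalModel_rpow hθ hγ₁
  have hself' := integrable_normalModel_rpow hθ' hγ₁
  rw [divergence, if_neg hγ.ne']
  simp only [mul_assoc (1 + 1 / γ)]
  rw [integral_add (by fun_prop) (by fun_prop), integral_sub hself' (by fun_prop),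
    integral_const_mul, integral_const_mul,
    integral_normalModel_rpow_mul hθ hθ' hγr, integral_normalModel_rpow hθ hγ₁,
    integral_normalModel_rpow hθ' hγ₁, hpeak]
  ring

lemma divergence_zero_normalModel (hθ : 0 < θ 1) (hθ' : 0 < θ' 1) :
    divergence 0 (normalModel θ) (normalModel θ') =
      ((θ 1 / θ' 1) ^ 2 - 1 - 2 * Real.log (θ 1 / θ' 1) + ((θ 0 - θ' 0) / θ' 1) ^ 2) / 2 := by
  have hpeak : Real.log (normalPeak (θ 1)) - Real.log (normalPeak (θ' 1)) =
      -Real.log (θ 1 / θ' 1) := by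
    rw [← Real.log_div (normalPeak_pos hθ).ne' (normalPeak_pos hθ').ne', ← Real.log_inv,
      normalPeak, normalPeak]
    congr 1
    field_simp
  have hlog : ∀ x, Real.log (normalModel θ x / normalModel θ' x) =
      (-Real.log (θ 1 / θ' 1) + ((θ 0 - θ' 0) / θ' 1) ^ 2 / 2) +
        (θ 1 / θ' 1 * ((θ 0 - θ' 0) / θ' 1)) * ((x - θ 0) / θ 1) +
        (((θ 1 / θ' 1) ^ 2 - 1) / 2) * ((x - θ 0) / θ 1) ^ 2 +
        0 * ((x - θ 0) / θ 1) ^ 3 + 0 * ((x - θ 0) / θ 1) ^ 4 := fun x => by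
    rw [Real.log_div (normalModel_pos hθ x).ne' (normalModel_pos hθ' x).ne', log_normalModel hθ,
      log_normalModel hθ', ← hpeak]
    field_simp
    ring
  have hint := integral_quartic_mul_normalModel_rpow hθ (β := 0) (by norm_num) _ _ _ _ _ hlog
  simp only [add_zero, Real.rpow_one, Real.rpow_zero, Real.sqrt_one] at hint
  simp only [divergence, if_true, mul_comm (normalModel θ _), hint]
  ring

lemma measurable_normalModel {α : Type*} [MeasurableSpace α] {a : α → Fin 2 → ℝ} {b : α → ℝ}
    (ha : Measurable a) (hb : Measurable b) : Measurable fun q => normalModel (a q) (b q) :=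
  measurable_uncurry_gaussianPDFReal.comp
    (f := fun q => (a q 0, Real.toNNReal (a q 1 ^ 2), b q)) (by fun_prop)

lemma measurable_testStat {Ω : Type*} [MeasurableSpace Ω] {est est₀ : ℕ → Ω → Fin 2 → ℝ}
    (hest : ∀ n, Measurable (est n)) (hest₀ : ∀ n, Measurable (est₀ n)) (n : ℕ) :
    Measurable (testStat γ normalModel est est₀ n) := by
  have hh : Measurable fun q : Ω × ℝ => normalModel (est n q.1) q.2 :=
    measurable_normalModel ((hest n).comp measurable_fst) measurable_snd
  have hf : Measurable fun q : Ω × ℝ => normalModel (est₀ n q.1) q.2 :=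
    measurable_normalModel ((hest₀ n).comp measurable_fst) measurable_snd
  refine Measurable.const_mul ?_ _
  rcases eq_or_ne γ 0 with rfl | hγ
  · simp only [divergence, if_true]
    exact (hh.mul (hh.div hf).log).stronglyMeasurable.integral_prod_right'.measurable
  · simp only [divergence, if_neg hγ]
    exact (((hf.pow_const _).sub (((hf.pow_const _).const_mul _).mul hh)).add
      ((hh.pow_const _).const_mul _)).stronglyMeasurable.integral_prod_right'.measurable

end Divergence

section Positivity

variable {θ θ' : Fin 2 → ℝ} {γ : ℝ}

/-- Bernoulli's inequality for `b / a`. -/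
lemma divergence_integrand_pos {a b : ℝ} (ha : 0 < a) (hb : 0 < b) (hab : a ≠ b) (hγ : 0 < γ) :
    0 < a ^ (1 + γ) - (1 + 1 / γ) * a ^ γ * b + 1 / γ * b ^ (1 + γ) := by
  have hbernoulli : 1 + (1 + γ) * (b / a - 1) < (b / a) ^ (1 + γ) := by
    have hne : b / a - 1 ≠ 0 := sub_ne_zero.2 fun h => hab ((div_eq_one_iff_eq ha.ne').1 h).symm
    have hlt := one_add_mul_self_lt_rpow_one_add (p := 1 + γ) (by linarith [div_pos hb ha]) hne
      (by linarith)
    rwa [add_sub_cancel] at hlt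
  have hfactor : a ^ (1 + γ) - (1 + 1 / γ) * a ^ γ * b + 1 / γ * b ^ (1 + γ) =
      a ^ (1 + γ) / γ * ((b / a) ^ (1 + γ) - (1 + (1 + γ) * (b / a - 1))) := by
    rw [Real.div_rpow hb.le ha.le, Real.rpow_one_add' ha.le (by linarith)]
    field_simp
    ring
  rw [hfactor]
  exact mul_pos (by positivity) (sub_pos.2 hbernoulli)

lemma divergence_pos {h f : ℝ → ℝ} (hh : Continuous h) (hf : Continuous f) (hh_pos : ∀ x, 0 < h x)
    (hf_pos : ∀ x, 0 < f x) (hne : h ≠ f) (hγ : 0 < γ)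
    (hint : Integrable fun x =>
      f x ^ (1 + γ) - (1 + 1 / γ) * f x ^ γ * h x + 1 / γ * h x ^ (1 + γ)) :
    0 < divergence γ h f := by
  obtain ⟨x₀, hx₀⟩ := Function.ne_iff.1 hne
  have hcont : Continuous fun x =>
      f x ^ (1 + γ) - (1 + 1 / γ) * f x ^ γ * h x + 1 / γ * h x ^ (1 + γ) :=
    ((hf.rpow_const fun x => Or.inl (hf_pos x).ne').sub ((continuous_const.mul
      (hf.rpow_const fun x => Or.inl (hf_pos x).ne')).mul hh)).add
        (continuous_const.mul (hh.rpow_const fun x => Or.inl (hh_pos x).ne'))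
  rw [divergence, if_neg hγ.ne']
  refine integral_pos_of_integrable_nonneg_nonzero hcont hint (fun x => ?_)
    (divergence_integrand_pos (hf_pos x₀) (hh_pos x₀) hx₀.symm hγ).ne'
  rcases eq_or_ne (f x) (h x) with heq | hfh
  · refine le_of_eq ?_
    rw [heq, Real.rpow_one_add' (hh_pos x).le (by linarith), Pi.zero_apply]
    ring
  · exact (divergence_integrand_pos (hf_pos x) (hh_pos x) hfh hγ).le

lemma continuous_normalModel (hθ : 0 < θ 1) : Continuous (normalModel θ) := by
  rw [funext (normalModel_eq hθ)]
  fun_prop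

lemma normalModel_injOn : Set.InjOn normalModel normalSpace := by
  intro θ (hθ : 0 < θ 1) θ' (hθ' : 0 < θ' 1) heq
  have hv : ∀ {s : ℝ}, 0 < s → (s ^ 2).toNNReal ≠ 0 := fun hs =>
    (Real.toNNReal_pos.2 (by positivity)).ne'
  have hmeasure : gaussianReal (θ 0) (θ 1 ^ 2).toNNReal =
      gaussianReal (θ' 0) (θ' 1 ^ 2).toNNReal := by
    rw [gaussianReal_of_var_ne_zero _ (hv hθ), gaussianReal_of_var_ne_zero _ (hv hθ')]
    exact congrArg _ (funext fun x => congrArg ENNReal.ofReal (congrFun heq x))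
  obtain ⟨hloc, hvar⟩ := gaussianReal_ext_iff.1 hmeasure
  rw [Real.toNNReal_eq_toNNReal_iff (sq_nonneg _) (sq_nonneg _), sq_eq_sq₀ hθ.le hθ'.le] at hvar
  ext i
  fin_cases i
  exacts [hloc, hvar]

lemma divergence_normalModel_pos (hθ : 0 < θ 1) (hθ' : 0 < θ' 1) (hne : θ ≠ θ') (hγ : 0 < γ) :
    0 < divergence γ (normalModel θ) (normalModel θ') := by
  have hγ₁ : 0 < 1 + γ := by linarith
  refine divergence_pos (continuous_normalModel hθ) (continuous_normalModel hθ')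
    (normalModel_pos hθ) (normalModel_pos hθ') (fun h => hne (normalModel_injOn hθ hθ' h)) hγ ?_
  simp only [mul_assoc (1 + 1 / γ)]
  exact ((integrable_normalModel_rpow hθ' hγ₁).sub
    ((integrable_normalModel_rpow_mul hθ hθ' (by positivity)).const_mul _)).add
      ((integrable_normalModel_rpow hθ hγ₁).const_mul _)

/-- The left-hand side is the divergence of the standard normal density from the `N(m, τ²)` density,
up to a positive factor. -/
lemma population_gap_pos {β m τ : ℝ} (hβ : 0 < β) (hτ : 0 < τ) (hne : m ≠ 0 ∨ τ ≠ 1) :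
    0 < 1 / √(1 + β) - (1 + 1 / β) * (∫ z, gaussWeight β ((z - m) / τ) ∂gaussianReal 0 1) +
      τ ^ β * (1 / √(1 + β) / β) := by
  have hne' : (![0, 1] : Fin 2 → ℝ) ≠ ![m, τ] := fun h =>
    hne.elim (fun hm => hm (congrFun h 0).symm) fun hτ => hτ (congrFun h 1).symm
  have hpos := divergence_normalModel_pos (θ := ![0, 1]) (θ' := ![m, τ]) one_pos hτ hne' hβ
  have hint : ∫ z, gaussWeight β ((z - m) / τ) ∂gaussianReal 0 1 =
      gaussWeight (β / (1 + β * (1 / τ) ^ 2)) ((0 - m) / τ) / √(1 + β * (1 / τ) ^ 2) := by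
    rw [← integral_gaussWeight_add_mul (by positivity) (by positivity)]
    congr! 3
    ring
  rw [divergence_normalModel one_pos hτ hβ] at hpos
  simp only [Matrix.cons_val_zero, Matrix.cons_val_one] at hpos
  rw [← hint] at hpos
  refine (pos_of_mul_pos_right hpos (Real.rpow_nonneg (normalPeak_pos hτ).le _)).trans_eq ?_
  rw [Real.rpow_neg (by positivity), ← Real.inv_rpow (by positivity), one_div τ, inv_inv]
  ring

end Positivity

section LogLikelihoodSeparation

lemma log_scale_gap_pos_of_le_abs_loc {ε z q m τ : ℝ} (hτ : 0 < τ) (hm : ε ≤ |m|)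
    (hz : |z| ≤ ε / 2) (hvar : 0 < q - z ^ 2 + ε ^ 2 / 4)
    (hq : q < 1 + Real.log (q - z ^ 2 + ε ^ 2 / 4)) :
    0 < 2 * Real.log τ + (q - 2 * m * z + m ^ 2) / τ ^ 2 - q := by
  have hdist : (ε / 2) ^ 2 ≤ (m - z) ^ 2 := by
    rw [← sq_abs (m - z)]
    exact pow_le_pow_left₀ ((abs_nonneg z).trans hz) (by linarith [abs_sub_abs_le_abs_sub m z]) 2
  have hle : q - z ^ 2 + ε ^ 2 / 4 ≤ q - 2 * m * z + m ^ 2 := by linarith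
  have hlog_mono := Real.log_le_log hvar hle
  have hlog := Real.log_le_sub_one_of_pos (div_pos (hvar.trans_le hle) (pow_pos hτ 2))
  rw [Real.log_div (hvar.trans_le hle).ne' (by positivity), Real.log_pow] at hlog
  push_cast at hlog
  linarith

lemma log_scale_gap_pos_of_le_sq {c z q m τ : ℝ} (hτ : 0 < τ)
    (hc : c * (1 + τ ^ 2) ≤ (τ - 1) ^ 2) (hvar : 1 - c ≤ q - z ^ 2) (hq : q < 1 + c) :
    0 < 2 * Real.log τ + (q - 2 * m * z + m ^ 2) / τ ^ 2 - q := by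
  have hlog := Real.one_sub_inv_le_log_of_pos hτ
  have hmoment : (1 - c) / τ ^ 2 ≤ (q - 2 * m * z + m ^ 2) / τ ^ 2 := by
    gcongr
    linarith [sq_nonneg (m - z)]
  have hsq : 0 ≤ 2 * (1 - τ⁻¹) + (1 - c) / τ ^ 2 - (1 + c) := by
    have heq : 2 * (1 - τ⁻¹) + (1 - c) / τ ^ 2 - (1 + c) =
        ((τ - 1) ^ 2 - c * (1 + τ ^ 2)) / τ ^ 2 := by
      field_simp
      ring
    rw [heq]
    exact div_nonneg (sub_nonneg.2 hc) (sq_nonneg τ)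
  linarith

lemma exists_pos_mul_one_add_sq_le {ε : ℝ} (hε : 0 < ε) :
    ∃ c > 0, ∀ τ : ℝ, ε ≤ |τ - 1| → c * (1 + τ ^ 2) ≤ (τ - 1) ^ 2 := by
  refine ⟨1 / (2 + 3 / ε ^ 2), by positivity, fun τ hτ => ?_⟩
  rw [one_div_mul_eq_div, div_le_iff₀ (by positivity)]
  have hle : 3 ≤ (τ - 1) ^ 2 * (3 / ε ^ 2) := by
    rw [mul_div_left_comm, le_mul_iff_one_le_right three_pos, one_le_div (by positivity),
      ← sq_abs (τ - 1)]
    gcongr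
  linarith [sq_nonneg (τ - 2)]

lemma avg_standardize_sq (x : ℕ → ℝ) {n : ℕ} (hn : n ≠ 0) (m τ : ℝ) :
    avg x n (fun z => ((z - m) / τ) ^ 2) =
      (avg x n (fun z => z ^ 2) - 2 * m * avg x n (fun z => z) + m ^ 2) / τ ^ 2 := by
  have hexpand : (fun z : ℝ => ((z - m) / τ) ^ 2) =
      fun z => (τ ^ 2)⁻¹ * (z ^ 2 - 2 * m * z + m ^ 2) := by
    ext z
    rw [div_pow, div_eq_inv_mul]
    ring
  rw [hexpand, avg_const_mul, avg_add, avg_const x hn, avg_sub, avg_const_mul, inv_mul_eq_div]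

variable {Ω : Type*} [MeasurableSpace Ω] {P : Measure Ω} [IsFiniteMeasure P] {Z : ℕ → Ω → ℝ}

lemma IsIIDSample.eventually_log_scale_gap_pos (hZ : IsIIDSample Z (gaussianReal 0 1) P) {ε : ℝ}
    (hε : 0 < ε) :
    ∀ᶠ p in inProb P atTop, ∀ m τ : ℝ, 0 < τ → (ε ≤ |m| ∨ ε ≤ |τ - 1|) →
      0 < 2 * Real.log τ + avg (fun k => Z k p.2) p.1 (fun z => ((z - m) / τ) ^ 2) -
        avg (fun k => Z k p.2) p.1 (fun z => z ^ 2) := by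
  obtain ⟨c, hc, hscale⟩ := exists_pos_mul_one_add_sq_le hε
  have hmean : Tendsto (fun p : ℕ × Ω => avg (fun k => Z k p.2) p.1 fun z => z)
      (inProb P atTop) (𝓝 0) := by
    simpa using hZ.tendsto_avg measurable_id'
      (by simpa using integrable_quartic_mul_gaussWeight (β := 0) (by simp) 0 1 0 0 0)
  have hsq : Tendsto (fun p : ℕ × Ω => avg (fun k => Z k p.2) p.1 fun z => z ^ 2)
      (inProb P atTop) (𝓝 1) := by
    have hint := integral_quartic_mul_gaussWeight (β := 0) (by simp) 0 0 1 0 0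
    simp only [zero_mul, zero_add, add_zero, one_mul, gaussWeight_zero_left, mul_one, mul_zero,
      zero_div, div_one, Real.sqrt_one] at hint
    rw [← hint]
    exact hZ.tendsto_avg (measurable_id'.pow_const 2)
      (by simpa using integrable_quartic_mul_gaussWeight (β := 0) (by simp) 0 0 1 0 0)
  have hvar := hsq.sub (hmean.pow 2)
  rw [zero_pow two_ne_zero, sub_zero] at hvar
  have hvar' := hvar.add_const (ε ^ 2 / 4)
  have hε₁ : 1 < 1 + ε ^ 2 / 4 := by linarith [pow_pos hε 2]
  filter_upwards [tendsto_fst_inProb.eventually (eventually_ne_atTop 0),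
    hmean.abs.eventually_le_const (show |(0 : ℝ)| < ε / 2 by simpa using hε),
    hvar'.eventually_const_lt (zero_lt_one.trans hε₁),
    hsq.eventually_lt ((hvar'.log (zero_lt_one.trans hε₁).ne').const_add 1)
      (lt_add_of_pos_right _ (Real.log_pos hε₁)),
    hvar.eventually_const_le (sub_lt_self 1 hc), hsq.eventually_lt_const (lt_add_of_pos_right 1 hc)]
    with p hn hz hvar_pos hlog hvar_le hq_lt m τ hτ hout
  rw [avg_standardize_sq _ hn]
  exact hout.elim (fun hm => log_scale_gap_pos_of_le_abs_loc hτ hm hz hvar_pos hlog) fun hs =>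
    log_scale_gap_pos_of_le_sq hτ (hscale τ hs) hvar_le hq_lt

end LogLikelihoodSeparation

section WeightSeparation

variable {β m τ : ℝ}

lemma gaussWeight_le_of_abs_le (hβ : 0 ≤ β) {u v : ℝ} (huv : |u| ≤ |v|) :
    gaussWeight β v ≤ gaussWeight β u := by
  have hsq := sq_le_sq.2 huv
  unfold gaussWeight
  gcongr

lemma tendsto_gaussWeight_atTop (hβ : 0 < β) : Tendsto (gaussWeight β) atTop (𝓝 0) := by
  refine Real.tendsto_exp_neg_atTop_nhds_zero.comp (Tendsto.atTop_div_const two_pos ?_)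
  exact (tendsto_pow_atTop two_ne_zero).const_mul_atTop hβ

lemma tendsto_integral_gaussWeight {ι : Type*} {l : Filter ι} [l.IsCountablyGenerated]
    {μ : Measure ℝ} [IsFiniteMeasure μ] {u : ι → ℝ → ℝ} {f : ℝ → ℝ} (hβ : 0 ≤ β)
    (hu : ∀ i, Measurable (u i))
    (hlim : ∀ᵐ z ∂μ, Tendsto (fun i => gaussWeight β (u i z)) l (𝓝 (f z))) :
    Tendsto (fun i => ∫ z, gaussWeight β (u i z) ∂μ) l (𝓝 (∫ z, f z ∂μ)) := by
  refine tendsto_integral_filter_of_dominated_convergence (fun _ => 1) (.of_forall fun i => ?_)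
    (.of_forall fun i => .of_forall fun z => ?_) (integrable_const _) hlim
  · exact ((continuous_gaussWeight β).measurable.comp (hu i)).aestronglyMeasurable
  · rw [Real.norm_of_nonneg (gaussWeight_pos _ _).le]
    exact gaussWeight_le_one hβ _

/-- `objective - objective₀` up to a positive factor, where `m` and `τ` are the location and the
scale relative to the true parameter and `x` is the standardized sample. -/
def sampleGap (β : ℝ) (x : ℕ → ℝ) (n : ℕ) (m τ : ℝ) : ℝ :=
  1 / √(1 + β) - (1 + 1 / β) * avg x n (fun z => gaussWeight β ((z - m) / τ)) +
    τ ^ β * ((1 + 1 / β) * avg x n (gaussWeight β) - 1 / √(1 + β))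

variable {Ω : Type*} [MeasurableSpace Ω] {P : Measure Ω} [IsFiniteMeasure P] {Z : ℕ → Ω → ℝ}

namespace IsIIDSample

lemma tendsto_avg_gaussWeight (hZ : IsIIDSample Z (gaussianReal 0 1) P) (hβ : 0 < β) :
    Tendsto (fun p : ℕ × Ω => (1 + 1 / β) * avg (fun k => Z k p.2) p.1 (gaussWeight β) -
      1 / √(1 + β)) (inProb P atTop) (𝓝 (1 / √(1 + β) / β)) := by
  have hβ₁ : 0 < 1 + β := by linarith
  have hint := integral_quartic_mul_gaussWeight hβ₁ 1 0 0 0 0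
  have hlim := hZ.tendsto_avg (continuous_gaussWeight β).measurable
    (by simpa using integrable_quartic_mul_gaussWeight hβ₁ 1 0 0 0 0)
  simp only [zero_mul, add_zero, one_mul, mul_zero, zero_div] at hint
  rw [hint] at hlim
  refine (hlim.const_mul (1 + 1 / β)).sub_const _ |>.trans_eq ?_
  congr 1
  ring

/-- The law of large numbers for the majorant `V` makes the sample gap positive uniformly over the
whole set `S`. -/
lemma eventually_sampleGap_pos_of_le (hZ : IsIIDSample Z (gaussianReal 0 1) P) (hβ : 0 < β)
    {S : Set (ℝ × ℝ)} {V : ℝ → ℝ} {t : ℝ} (hV : Measurable V)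
    (hVint : Integrable V (gaussianReal 0 1)) (ht : 0 ≤ t)
    (hSV : ∀ q ∈ S, ∀ z, gaussWeight β ((z - q.1) / q.2) ≤ V z) (hSt : ∀ q ∈ S, t ≤ q.2)
    (hpos : 0 < 1 / √(1 + β) - (1 + 1 / β) * (∫ z, V z ∂gaussianReal 0 1) +
      t ^ β * (1 / √(1 + β) / β)) :
    ∀ᶠ p in inProb P atTop, ∀ q ∈ S, 0 < sampleGap β (fun k => Z k p.2) p.1 q.1 q.2 := by
  have hweight := hZ.tendsto_avg_gaussWeight hβ
  have hlim := (((hZ.tendsto_avg hV hVint).const_mul (1 + 1 / β)).const_sub (1 / √(1 + β))).add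
    (hweight.const_mul (t ^ β))
  filter_upwards [hlim.eventually_const_lt hpos,
    hweight.eventually_const_lt (show 0 < 1 / √(1 + β) / β by positivity)]
    with p hgap hweight_pos q hq
  have havg := avg_mono (fun k => Z k p.2) p.1 (hSV q hq)
  have hscale := hSt q hq
  refine hgap.trans_le ?_
  unfold sampleGap
  gcongr

lemma exists_forall_eventually_sampleGap_pos_of_le_scale
    (hZ : IsIIDSample Z (gaussianReal 0 1) P) (hβ : 0 < β) :
    ∃ T > 0, ∀ᶠ p in inProb P atTop, ∀ q : ℝ × ℝ, T ≤ q.2 →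
      0 < sampleGap β (fun k => Z k p.2) p.1 q.1 q.2 := by
  have hlim : Tendsto (fun T : ℝ => 1 / √(1 + β) - (1 + 1 / β) * (∫ _, 1 ∂gaussianReal 0 1) +
      T ^ β * (1 / √(1 + β) / β)) atTop atTop :=
    tendsto_atTop_add_const_left _ _
      ((tendsto_rpow_atTop hβ).atTop_mul_const (by positivity))
  obtain ⟨T, hT, hpos⟩ := ((eventually_gt_atTop 0).and (hlim.eventually_gt_atTop 0)).exists
  exact ⟨T, hT, hZ.eventually_sampleGap_pos_of_le hβ (S := {q | T ≤ q.2}) measurable_const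
    (integrable_const 1) hT.le (fun _ _ _ => gaussWeight_le_one hβ.le _) (fun _ hq => hq) hpos⟩

lemma exists_forall_eventually_sampleGap_pos_of_le_abs_loc
    (hZ : IsIIDSample Z (gaussianReal 0 1) P) (hβ : 0 < β) {T : ℝ} (hT : 0 < T) :
    ∃ M, ∀ᶠ p in inProb P atTop, ∀ q : ℝ × ℝ, M ≤ |q.1| → 0 < q.2 → q.2 ≤ T →
      0 < sampleGap β (fun k => Z k p.2) p.1 q.1 q.2 := by
  have hmeas : ∀ M, Measurable fun z : ℝ => max 0 (M - |z|) / T := fun M => by fun_prop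
  have hlim : Tendsto (fun M => ∫ z, gaussWeight β (max 0 (M - |z|) / T) ∂gaussianReal 0 1) atTop
      (𝓝 (∫ _, 0 ∂gaussianReal 0 1)) :=
    tendsto_integral_gaussWeight hβ.le hmeas <| .of_forall fun z =>
      (tendsto_gaussWeight_atTop hβ).comp <| Tendsto.atTop_div_const hT <|
        tendsto_atTop_mono (fun M => le_max_right 0 (M - |z|)) <|
          tendsto_atTop_add_const_right _ _ tendsto_id
  rw [integral_zero] at hlim
  obtain ⟨M, hM⟩ := (((hlim.const_mul (1 + 1 / β)).const_sub (1 / √(1 + β))).eventually_const_lt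
    (show 0 < 1 / √(1 + β) - (1 + 1 / β) * 0 by rw [mul_zero, sub_zero]; positivity)).exists
  refine ⟨M, ?_⟩
  have hgap := hZ.eventually_sampleGap_pos_of_le hβ (S := {q | M ≤ |q.1| ∧ 0 < q.2 ∧ q.2 ≤ T})
    ((continuous_gaussWeight β).measurable.comp (hmeas M))
    (integrable_gaussWeight_comp hβ.le (hmeas M)) le_rfl ?_ (fun q hq => hq.2.1.le)
    (by rwa [Real.zero_rpow hβ.ne', zero_mul, add_zero])
  · filter_upwards [hgap] with p hp q hM hpos hT using hp q ⟨hM, hpos, hT⟩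
  · rintro ⟨m, τ⟩ ⟨hm, hτ, hτT⟩ z
    have hdist : max 0 (M - |z|) ≤ |z - m| :=
      max_le (abs_nonneg _) (by linarith [abs_sub_abs_le_abs_sub m z, abs_sub_comm m z])
    refine gaussWeight_le_of_abs_le hβ.le ?_
    calc |max 0 (M - |z|) / T| = max 0 (M - |z|) / T := abs_of_nonneg (by positivity)
      _ ≤ |z - m| / τ := by dsimp only at hτ hτT; gcongr
      _ = |(z - m) / τ| := by rw [abs_div, abs_of_pos hτ]

/-- The limit `I` is a parameter because at `τ = 0` the weights degenerate and their integrals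
do not tend to the integral of a weight. -/
lemma exists_nhds_eventually_sampleGap_pos_of_tendsto (hZ : IsIIDSample Z (gaussianReal 0 1) P)
    (hβ : 0 < β) (hτ : 0 ≤ τ) {I : ℝ}
    (hlim : Tendsto
      (fun δ => ∫ z, gaussWeight β (max 0 (|z - m| - δ) / (τ + δ)) ∂gaussianReal 0 1)
      (𝓝[>] 0) (𝓝 I))
    (hpos : 0 < 1 / √(1 + β) - (1 + 1 / β) * I + τ ^ β * (1 / √(1 + β) / β)) :
    ∃ U ∈ 𝓝 (m, τ), ∀ᶠ p in inProb P atTop, ∀ q ∈ U, 0 < q.2 →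
      0 < sampleGap β (fun k => Z k p.2) p.1 q.1 q.2 := by
  have hscale : Tendsto (fun δ => max 0 (τ - δ) ^ β) (𝓝[>] 0) (𝓝 (τ ^ β)) := by
    have hcont : ContinuousAt (fun δ => max 0 (τ - δ) ^ β) 0 :=
      ContinuousAt.rpow_const (by fun_prop) (Or.inr hβ.le)
    simpa [max_eq_right hτ] using hcont.tendsto.mono_left nhdsWithin_le_nhds
  obtain ⟨δ, hgap, hδ : 0 < δ⟩ :=
    (((((hlim.const_mul (1 + 1 / β)).const_sub (1 / √(1 + β))).add
      (hscale.mul_const (1 / √(1 + β) / β))).eventually_const_lt hpos).and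
        self_mem_nhdsWithin).exists
  have hmeas : Measurable fun z : ℝ => max 0 (|z - m| - δ) / (τ + δ) := by fun_prop
  refine ⟨Metric.ball (m, τ) δ, Metric.ball_mem_nhds _ hδ, ?_⟩
  have hball := hZ.eventually_sampleGap_pos_of_le hβ
    (S := {q | q ∈ Metric.ball (m, τ) δ ∧ 0 < q.2})
    ((continuous_gaussWeight β).measurable.comp hmeas) (integrable_gaussWeight_comp hβ.le hmeas)
    (le_max_left 0 (τ - δ)) ?_ ?_ hgap
  · filter_upwards [hball] with p hp q hq hpos using hp q ⟨hq, hpos⟩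
  all_goals
    rintro ⟨m', τ'⟩ ⟨hq, hτ' : 0 < τ'⟩
    rw [Metric.mem_ball, Prod.dist_eq, max_lt_iff, Real.dist_eq, Real.dist_eq, abs_lt, abs_lt] at hq
    obtain ⟨hm', hτ_dist⟩ := hq
  · intro z
    have hdist : max 0 (|z - m| - δ) ≤ |z - m'| :=
      max_le (abs_nonneg _) (by linarith [abs_sub_le z m' m, abs_lt.2 hm'])
    refine gaussWeight_le_of_abs_le hβ.le ?_
    calc |max 0 (|z - m| - δ) / (τ + δ)| = max 0 (|z - m| - δ) / (τ + δ) :=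
          abs_of_nonneg (by positivity)
      _ ≤ |z - m'| / τ' := by gcongr; linarith
      _ = |(z - m') / τ'| := by rw [abs_div, abs_of_pos hτ']
  · exact max_le hτ'.le (by linarith)

lemma exists_nhds_eventually_sampleGap_pos (hZ : IsIIDSample Z (gaussianReal 0 1) P)
    (hβ : 0 < β) (hτ : 0 ≤ τ) (hne : m ≠ 0 ∨ τ ≠ 1) :
    ∃ U ∈ 𝓝 (m, τ), ∀ᶠ p in inProb P atTop, ∀ q ∈ U, 0 < q.2 →
      0 < sampleGap β (fun k => Z k p.2) p.1 q.1 q.2 := by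
  have hmeas : ∀ δ, Measurable fun z : ℝ => max 0 (|z - m| - δ) / (τ + δ) := fun δ => by fun_prop
  have hnum : ∀ z, Tendsto (fun δ => max 0 (|z - m| - δ)) (𝓝[>] 0) (𝓝 |z - m|) := fun z => by
    have hcont : Continuous fun δ => max 0 (|z - m| - δ) := by fun_prop
    simpa using (hcont.tendsto 0).mono_left nhdsWithin_le_nhds
  have hden : Tendsto (fun δ => τ + δ) (𝓝[>] 0) (𝓝 τ) := by
    simpa using tendsto_nhdsWithin_of_tendsto_nhds (s := Set.Ioi 0)
      ((continuous_const_add τ).tendsto 0)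
  rcases hτ.eq_or_lt with rfl | hτ_pos
  · refine hZ.exists_nhds_eventually_sampleGap_pos_of_tendsto (I := ∫ _, 0 ∂gaussianReal 0 1) hβ
      le_rfl (tendsto_integral_gaussWeight hβ.le hmeas ?_) ?_
    · have := nullSingletonClass_gaussianReal (μ := 0) one_ne_zero
      filter_upwards [Measure.ae_ne (gaussianReal 0 1) m] with z hz
      simp only [zero_add]
      exact (tendsto_gaussWeight_atTop hβ).comp
        ((hnum z).pos_mul_atTop (abs_pos.2 (sub_ne_zero.2 hz)) tendsto_inv_nhdsGT_zero)
    · rw [integral_zero, mul_zero, sub_zero]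
      positivity
  · refine hZ.exists_nhds_eventually_sampleGap_pos_of_tendsto hβ hτ
      (tendsto_integral_gaussWeight hβ.le hmeas (.of_forall fun z => ?_))
      (population_gap_pos hβ hτ_pos hne)
    have habs : gaussWeight β ((z - m) / τ) = gaussWeight β (|z - m| / τ) := by
      rw [gaussWeight, gaussWeight, div_pow, div_pow, sq_abs]
    rw [habs]
    exact ((continuous_gaussWeight β).tendsto _).comp ((hnum z).div hden hτ_pos.ne')

lemma eventually_sampleGap_pos_of_isCompact (hZ : IsIIDSample Z (gaussianReal 0 1) P)
    (hβ : 0 < β) {K : Set (ℝ × ℝ)} (hK : IsCompact K)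
    (hne : ∀ q ∈ K, 0 ≤ q.2 ∧ (q.1 ≠ 0 ∨ q.2 ≠ 1)) :
    ∀ᶠ p in inProb P atTop, ∀ q ∈ K, 0 < q.2 →
      0 < sampleGap β (fun k => Z k p.2) p.1 q.1 q.2 := by
  apply hK.induction_on (p := fun S => ∀ᶠ p in inProb P atTop, ∀ q ∈ S, 0 < q.2 →
    0 < sampleGap β (fun k => Z k p.2) p.1 q.1 q.2)
  · exact .of_forall fun p q hq => absurd hq (Set.notMem_empty q)
  · exact fun S S' hSS' hS' => hS'.mono fun p hp q hq => hp q (hSS' hq)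
  · exact fun S S' hS hS' => (hS.and hS').mono fun p hp q hq => hq.elim (hp.1 q) (hp.2 q)
  · intro q hq
    obtain ⟨U, hU, hpos⟩ := hZ.exists_nhds_eventually_sampleGap_pos hβ (hne q hq).1 (hne q hq).2
    exact ⟨U, mem_nhdsWithin_of_mem_nhds hU, hpos⟩

lemma eventually_sampleGap_pos (hZ : IsIIDSample Z (gaussianReal 0 1) P) (hβ : 0 < β) {ε : ℝ}
    (hε : 0 < ε) :
    ∀ᶠ p in inProb P atTop, ∀ m τ : ℝ, 0 < τ → (ε ≤ |m| ∨ ε ≤ |τ - 1|) →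
      0 < sampleGap β (fun k => Z k p.2) p.1 m τ := by
  obtain ⟨T, hT, hscale⟩ := hZ.exists_forall_eventually_sampleGap_pos_of_le_scale hβ
  obtain ⟨M, hloc⟩ := hZ.exists_forall_eventually_sampleGap_pos_of_le_abs_loc hβ hT
  have hclosed : IsClosed {q : ℝ × ℝ | ε ≤ |q.1| ∨ ε ≤ |q.2 - 1|} :=
    (isClosed_le (f := fun _ => ε) (g := fun q : ℝ × ℝ => |q.1|) (by fun_prop) (by fun_prop)).union
      (isClosed_le (f := fun _ => ε) (g := fun q : ℝ × ℝ => |q.2 - 1|) (by fun_prop) (by fun_prop))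
  have hcompact := hZ.eventually_sampleGap_pos_of_isCompact hβ
    ((isCompact_Icc (a := (-M, 0)) (b := (M, T))).inter_right hclosed) <| by
      rintro ⟨m, τ⟩ ⟨hbox, hne⟩
      refine ⟨hbox.1.2, hne.imp ?_ ?_⟩ <;> rintro hout rfl
      · exact hε.not_ge (by simpa using hout)
      · exact hε.not_ge (by simpa using hout)
  filter_upwards [hscale, hloc, hcompact] with p hp_scale hp_loc hp_compact m τ hτ hne
  rcases le_total T τ with hTτ | hTτ
  · exact hp_scale (m, τ) hTτ
  rcases le_total M |m| with hMm | hMm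
  · exact hp_loc (m, τ) hMm hτ hTτ
  · exact hp_compact (m, τ) ⟨⟨⟨(abs_le.1 hMm).1, hτ.le⟩, (abs_le.1 hMm).2, hTτ⟩, hne⟩ hτ

end IsIIDSample

end WeightSeparation

section Estimators

variable {θ θ₀ : Fin 2 → ℝ} {β : ℝ}

lemma avg_comp_standardize (x : ℕ → ℝ) (n : ℕ) (g : ℝ → ℝ) (hθ₀ : 0 < θ₀ 1) :
    avg x n (fun y => g ((y - θ 0) / θ 1)) =
      avg (fun k => (x k - θ₀ 0) / θ₀ 1) n
        (fun z => g ((z - (θ 0 - θ₀ 0) / θ₀ 1) / (θ 1 / θ₀ 1))) := by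
  simp only [avg, ← sub_div, sub_sub_sub_cancel_right, div_div_div_cancel_right₀ hθ₀.ne']

lemma objective_sub_objective (hθ : 0 < θ 1) (hθ₀ : 0 < θ₀ 1) (hβ : 0 < 1 + β) (hβ₀ : β ≠ 0)
    (x : ℕ → ℝ) (n : ℕ) :
    objective β normalModel x n θ - objective β normalModel x n θ₀ =
      normalPeak (θ 1) ^ β * sampleGap β (fun k => (x k - θ₀ 0) / θ₀ 1) n
        ((θ 0 - θ₀ 0) / θ₀ 1) (θ 1 / θ₀ 1) := by
  have hself : avg x n (fun y => gaussWeight β ((y - θ₀ 0) / θ₀ 1)) =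
      avg (fun k => (x k - θ₀ 0) / θ₀ 1) n (gaussWeight β) := rfl
  rw [objective_normalModel hθ hβ hβ₀, objective_normalModel hθ₀ hβ hβ₀,
    normalPeak_rpow_eq_mul hθ₀ hθ, avg_comp_standardize _ _ _ hθ₀, hself, sampleGap]
  ring

lemma objective_zero_sub_objective_zero (hθ : 0 < θ 1) (hθ₀ : 0 < θ₀ 1) (x : ℕ → ℝ) {n : ℕ}
    (hn : n ≠ 0) :
    objective 0 normalModel x n θ - objective 0 normalModel x n θ₀ =
      (2 * Real.log (θ 1 / θ₀ 1) + avg (fun k => (x k - θ₀ 0) / θ₀ 1) n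
          (fun z => ((z - (θ 0 - θ₀ 0) / θ₀ 1) / (θ 1 / θ₀ 1)) ^ 2) -
        avg (fun k => (x k - θ₀ 0) / θ₀ 1) n (fun z => z ^ 2)) / 2 := by
  have hobj : ∀ {θ : Fin 2 → ℝ}, 0 < θ 1 → objective 0 normalModel x n θ =
      avg x n (fun y => ((y - θ 0) / θ 1) ^ 2) / 2 + Real.log (√(2 * Real.pi)) +
        Real.log (θ 1) := fun {θ} hθ => by
    simp only [objective_zero_normalModel hθ, div_eq_inv_mul (_ ^ 2) (2 : ℝ)]
    rw [avg_sub, avg_const x hn, avg_const_mul, normalPeak, Real.log_inv,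
      Real.log_mul (by positivity) hθ.ne']
    ring
  have hself : avg x n (fun y => ((y - θ₀ 0) / θ₀ 1) ^ 2) =
      avg (fun k => (x k - θ₀ 0) / θ₀ 1) n (fun z => z ^ 2) := rfl
  rw [hobj hθ, hobj hθ₀, avg_comp_standardize _ _ (fun z => z ^ 2) hθ₀, hself,
    Real.log_div hθ.ne' hθ₀.ne']
  ring

lemma exists_isMinOn_of_separated {E : Type*} [MetricSpace E] [ProperSpace E] {Q : E → ℝ}
    {U C : Set E} {a : E} {ε : ℝ} (hQ : ContinuousOn Q U) (hC : IsClosed C) (ha : a ∈ C)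
    (hε : 0 ≤ ε) (hball : Metric.closedBall a ε ⊆ U)
    (hsep : ∀ b ∈ U, ε ≤ dist b a → Q a < Q b) :
    ∃ b ∈ U ∩ C, IsMinOn Q (U ∩ C) b := by
  have haK : a ∈ Metric.closedBall a ε ∩ C := ⟨Metric.mem_closedBall_self hε, ha⟩
  obtain ⟨b, hbK, hb⟩ := ((isCompact_closedBall a ε).inter_right hC).exists_isMinOn ⟨a, haK⟩
    (hQ.mono fun _ h => hball h.1)
  refine ⟨b, ⟨hball hbK.1, hbK.2⟩, fun c hc => ?_⟩
  rcases le_or_gt (dist c a) ε with hnear | hfar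
  · exact hb ⟨hnear, hc.2⟩
  · exact (hb haK).trans (hsep c hc.1 hfar.le).le

lemma closedBall_subset_normalSpace {ε : ℝ} (hε : ε < θ₀ 1) :
    Metric.closedBall θ₀ ε ⊆ normalSpace := by
  intro θ hθ
  have hcoord := (dist_le_pi_dist θ θ₀ 1).trans hθ
  rw [Real.dist_eq] at hcoord
  exact show 0 < θ 1 by linarith [neg_abs_le (θ 1 - θ₀ 1)]

variable {Ω : Type*} [MeasurableSpace Ω] {P : Measure Ω} {X : ℕ → Ω → ℝ}
  {est : ℕ → Ω → Fin 2 → ℝ} {C : Set (Fin 2 → ℝ)} {μ₀ : ℝ}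

lemma IsIIDSample.standardize
    (hX : IsIIDSample X (gaussianReal (θ₀ 0) (θ₀ 1 ^ 2).toNNReal) P) (hθ₀ : 0 < θ₀ 1) :
    IsIIDSample (fun k ω => (X k ω - θ₀ 0) / θ₀ 1) (gaussianReal 0 1) P := by
  rw [← gaussianReal_map_standardize (θ₀ 0) hθ₀.ne']
  exact hX.comp (φ := fun x => (x - θ₀ 0) / θ₀ 1) (by fun_prop)

section Consistency

variable [IsFiniteMeasure P]

lemma IsIIDSample.eventually_objective_lt
    (hX : IsIIDSample X (gaussianReal (θ₀ 0) (θ₀ 1 ^ 2).toNNReal) P) (hθ₀ : 0 < θ₀ 1)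
    (hβ : 0 ≤ β) {ε : ℝ} (hε : 0 < ε) :
    ∀ᶠ p in inProb P atTop, ∀ θ ∈ normalSpace, ε ≤ dist θ θ₀ →
      objective β normalModel (fun k => X k p.2) p.1 θ₀ <
        objective β normalModel (fun k => X k p.2) p.1 θ := by
  have hZ := hX.standardize hθ₀
  have hout : ∀ θ, ε ≤ dist θ θ₀ →
      ε / θ₀ 1 ≤ |(θ 0 - θ₀ 0) / θ₀ 1| ∨ ε / θ₀ 1 ≤ |θ 1 / θ₀ 1 - 1| := fun θ hθ => by
    rw [div_sub_one hθ₀.ne', abs_div, abs_div, abs_of_pos hθ₀, div_le_div_iff_of_pos_right hθ₀,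
      div_le_div_iff_of_pos_right hθ₀]
    contrapose! hθ
    rw [dist_pi_lt_iff hε, Fin.forall_fin_two, Real.dist_eq, Real.dist_eq]
    exact hθ
  rcases hβ.eq_or_lt with rfl | hβ_pos
  · filter_upwards [hZ.eventually_log_scale_gap_pos (div_pos hε hθ₀),
      tendsto_fst_inProb.eventually (eventually_ne_atTop 0)] with p hp hn θ hθ hdist
    rw [← sub_pos, objective_zero_sub_objective_zero hθ hθ₀ _ hn]
    exact half_pos (hp _ _ (div_pos hθ hθ₀) (hout θ hdist))
  · filter_upwards [hZ.eventually_sampleGap_pos hβ_pos (div_pos hε hθ₀)] with p hp θ hθ hdist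
    rw [← sub_pos, objective_sub_objective hθ hθ₀ (by linarith) hβ_pos.ne']
    exact mul_pos (Real.rpow_pos_of_pos (normalPeak_pos hθ) β)
      (hp _ _ (div_pos hθ hθ₀) (hout θ hdist))

lemma IsMinimizing.eventually_isMinOn
    (hest : IsMinimizing P β normalModel (normalSpace ∩ C) X est)
    (hX : IsIIDSample X (gaussianReal (θ₀ 0) (θ₀ 1 ^ 2).toNNReal) P) (hθ₀ : 0 < θ₀ 1)
    (hβ : 0 ≤ β) (hC : IsClosed C) (hmem : θ₀ ∈ C) :
    ∀ᶠ p in inProb P atTop, est p.1 p.2 ∈ normalSpace ∩ C ∧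
      IsMinOn (objective β normalModel (fun k => X k p.2) p.1) (normalSpace ∩ C)
        (est p.1 p.2) := by
  have hattained : ∀ᶠ p in inProb P atTop, (∃ θ ∈ normalSpace ∩ C,
      IsMinOn (objective β normalModel (fun k => X k p.2) p.1) (normalSpace ∩ C) θ) →
      est p.1 p.2 ∈ normalSpace ∩ C ∧ IsMinOn (objective β normalModel (fun k => X k p.2) p.1)
        (normalSpace ∩ C) (est p.1 p.2) := by
    simp only [eventually_inProb_iff, Classical.not_imp]
    exact hest
  filter_upwards [hattained, hX.eventually_objective_lt hθ₀ hβ (half_pos hθ₀)] with p hp hsep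
  exact hp (exists_isMinOn_of_separated (continuousOn_objective (by linarith) _ _) hC hmem
    (half_pos hθ₀).le (closedBall_subset_normalSpace (half_lt_self hθ₀)) hsep)

lemma IsMinimizing.tendsto (hest : IsMinimizing P β normalModel (normalSpace ∩ C) X est)
    (hX : IsIIDSample X (gaussianReal (θ₀ 0) (θ₀ 1 ^ 2).toNNReal) P) (hθ₀ : 0 < θ₀ 1)
    (hβ : 0 ≤ β) (hC : IsClosed C) (hmem : θ₀ ∈ C) :
    Tendsto (fun p : ℕ × Ω => est p.1 p.2) (inProb P atTop) (𝓝 θ₀) := by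
  refine Metric.tendsto_nhds.2 fun ε hε => ?_
  filter_upwards [hest.eventually_isMinOn hX hθ₀ hβ hC hmem,
    hX.eventually_objective_lt hθ₀ hβ hε] with p hp hsep
  exact lt_of_not_ge fun hfar => (hsep _ hp.1.1 hfar).not_ge (hp.2 ⟨hθ₀, hmem⟩)

lemma IsMDPDE.tendsto (hest : IsMDPDE P β normalModel normalSpace θ₀ X est)
    (hX : IsIIDSample X (gaussianReal (θ₀ 0) (θ₀ 1 ^ 2).toNNReal) P) (hθ₀ : 0 < θ₀ 1)
    (hβ : 0 ≤ β) : Tendsto (fun p : ℕ × Ω => est p.1 p.2) (inProb P atTop) (𝓝 θ₀) := by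
  rcases hest.2 with hmin | hroot
  · rw [← Set.inter_univ normalSpace] at hmin
    exact hmin.tendsto hX hθ₀ hβ isClosed_univ trivial
  · exact tendsto_inProb_iff_tendstoInMeasure.2 hroot.1

lemma IsMDPDE.eventually_avg_eq_zero (hest : IsMDPDE P β normalModel normalSpace θ₀ X est)
    (hX : IsIIDSample X (gaussianReal (θ₀ 0) (θ₀ 1 ^ 2).toNNReal) P) (hθ₀ : 0 < θ₀ 1)
    (hβ : 0 ≤ β) :
    ∀ᶠ p in inProb P atTop,
      avg (fun k => X k p.2) p.1
        (fun y => locScore β ((y - est p.1 p.2 0) / est p.1 p.2 1)) = 0 ∧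
      avg (fun k => X k p.2) p.1
        (fun y => scaleScore β ((y - est p.1 p.2 0) / est p.1 p.2 1)) = 0 := by
  have hβ₁ : 0 < 1 + β := by linarith
  have hroot : ∀ᶠ p in inProb P atTop, est p.1 p.2 ∈ normalSpace ∧
      ∀ i, estimatingFun β normalModel (fun k => X k p.2) p.1 (est p.1 p.2) i = 0 := by
    rcases hest.2 with hmin | hroot
    · rw [← Set.inter_univ normalSpace] at hmin
      filter_upwards [hmin.eventually_isMinOn hX hθ₀ hβ isClosed_univ trivial] with p hp
      refine ⟨hp.1.1, fun i => estimatingFun_eq_zero_of_isMinOn hp.1.1 hβ₁ hp.2 i ?_⟩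
      filter_upwards [eventually_update_one_pos hp.1.1 i] with t ht using ⟨ht, trivial⟩
    · exact eventually_inProb_iff.2 hroot.2
  filter_upwards [hroot, tendsto_fst_inProb.eventually (eventually_ne_atTop 0)] with p hp hn
  exact ⟨(estimatingFun_loc_eq_zero_iff hp.1 hβ₁ _ _).1 (hp.2 0),
    (estimatingFun_scale_eq_zero_iff hp.1 hβ₁ _ hn).1 (hp.2 1)⟩

lemma isClosed_normalNull_eq_zero (μ₀ : ℝ) : IsClosed {θ | normalNull μ₀ θ = 0} := by
  refine isClosed_eq ?_ continuous_const
  unfold normalNull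
  fun_prop

lemma IsRMDPDE.tendsto
    (hest : IsRMDPDE P β normalModel normalSpace (normalNull (θ₀ 0)) θ₀ X est)
    (hX : IsIIDSample X (gaussianReal (θ₀ 0) (θ₀ 1 ^ 2).toNNReal) P) (hθ₀ : 0 < θ₀ 1)
    (hβ : 0 ≤ β) : Tendsto (fun p : ℕ × Ω => est p.1 p.2) (inProb P atTop) (𝓝 θ₀) := by
  rcases hest.2 with hmin | hroot
  · exact IsMinimizing.tendsto hmin hX hθ₀ hβ (isClosed_normalNull_eq_zero _)
      (funext fun _ => sub_self _)
  · exact tendsto_inProb_iff_tendstoInMeasure.2 hroot.1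

lemma normalNull_eq_zero_iff : normalNull μ₀ θ = 0 ↔ θ 0 = μ₀ :=
  funext_iff.trans ((forall_const _).trans sub_eq_zero)

lemma IsRMDPDE.eventually_avg_eq_zero
    (hest : IsRMDPDE P β normalModel normalSpace (normalNull (θ₀ 0)) θ₀ X est)
    (hX : IsIIDSample X (gaussianReal (θ₀ 0) (θ₀ 1 ^ 2).toNNReal) P) (hθ₀ : 0 < θ₀ 1)
    (hβ : 0 ≤ β) :
    ∀ᶠ p in inProb P atTop, est p.1 p.2 0 = θ₀ 0 ∧
      avg (fun k => X k p.2) p.1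
        (fun y => scaleScore β ((y - est p.1 p.2 0) / est p.1 p.2 1)) = 0 := by
  have hβ₁ : 0 < 1 + β := by linarith
  have hn := tendsto_fst_inProb (P := P) |>.eventually (eventually_ne_atTop 0)
  have hroot : ∀ᶠ p in inProb P atTop,
      (est p.1 p.2 ∈ normalSpace ∧ normalNull (θ₀ 0) (est p.1 p.2) = 0) ∧
      estimatingFun β normalModel (fun k => X k p.2) p.1 (est p.1 p.2) 1 = 0 := by
    rcases hest.2 with hmin | hroot
    · filter_upwards [IsMinimizing.eventually_isMinOn hmin hX hθ₀ hβ
        (isClosed_normalNull_eq_zero _) (normalNull_eq_zero_iff.2 rfl)] with p hp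
      refine ⟨hp.1, estimatingFun_eq_zero_of_isMinOn hp.1.1 hβ₁ hp.2 1 ?_⟩
      filter_upwards [eventually_update_one_pos hp.1.1 1] with t ht using ⟨ht, hp.1.2⟩
    · have hlagrange : ∀ᶠ p in inProb P atTop, est p.1 p.2 ∈ normalSpace ∧
          normalNull (θ₀ 0) (est p.1 p.2) = 0 ∧ ∃ l : Fin 1 → ℝ, ∀ i,
            -((p.1 : ℝ) * estimatingFun β normalModel (fun k => X k p.2) p.1 (est p.1 p.2) i) +
              (matG (normalNull (θ₀ 0)) (est p.1 p.2)).mulVec l i = 0 :=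
        eventually_inProb_iff.2 hroot.2
      filter_upwards [hlagrange, hn] with p hp hn
      obtain ⟨hpos, hnull, l, hl⟩ := hp
      have hscale := hl 1
      rw [matG_normalNull] at hscale
      exact ⟨⟨hpos, hnull⟩, by simpa [Matrix.mulVec, dotProduct, hn] using hscale⟩
  filter_upwards [hroot, hn] with p hp hn
  exact ⟨normalNull_eq_zero_iff.1 hp.1.2,
    (estimatingFun_scale_eq_zero_iff hp.1.1 hβ₁ _ hn).1 hp.2⟩

end Consistency

end Estimators

section Taylor

lemma abs_taylor_remainder_le {h h' h'' : ℝ → ℝ} {C : ℝ} (hd : ∀ z, HasDerivAt h (h' z) z)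
    (hd' : ∀ z, HasDerivAt h' (h'' z) z) (hC : ∀ z, |h'' z| ≤ C) (z t : ℝ) :
    |h (z + t) - h z - t * h' z| ≤ C * t ^ 2 := by
  have hlip (s : ℝ) : |h' (z + s) - h' z| ≤ C * |s| := by
    simpa using convex_univ.norm_image_sub_le_of_norm_hasDerivWithin_le
      (fun x _ => (hd' x).hasDerivWithinAt) (fun x _ => hC x) (Set.mem_univ z)
      (Set.mem_univ (z + s))
  have hrem (s : ℝ) : HasDerivAt (fun s => h (z + s) - s * h' z) (h' (z + s) - h' z) s := by
    simpa using ((hd (z + s)).comp_const_add z s).fun_sub ((hasDerivAt_id' s).mul_const (h' z))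
  have hC0 : 0 ≤ C := (abs_nonneg _).trans (hC 0)
  have hmvt := (convex_Icc (-|t|) |t|).norm_image_sub_le_of_norm_hasDerivWithin_le
    (fun s _ => (hrem s).hasDerivWithinAt)
    (fun s hs => (hlip s).trans (mul_le_mul_of_nonneg_left (abs_le.2 hs) hC0))
    (x := 0) (y := t) ⟨neg_nonpos.2 (abs_nonneg t), abs_nonneg t⟩ ⟨neg_abs_le t, le_abs_self t⟩
  simp only [add_zero, zero_mul, sub_zero, Real.norm_eq_abs] at hmvt
  calc |h (z + t) - h z - t * h' z| = |h (z + t) - t * h' z - h z| := by congr 1; ring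
    _ ≤ C * |t| * |t| := hmvt
    _ = C * t ^ 2 := by rw [mul_assoc, ← sq, sq_abs]

/-- The derivative of `locScore`. -/
def locScoreDeriv (β z : ℝ) : ℝ := (1 - β * z ^ 2) * gaussWeight β z

/-- The derivative of `scaleScore`. -/
def scaleScoreDeriv (β z : ℝ) : ℝ := ((2 + β) * z - β * z ^ 3) * gaussWeight β z

variable {β : ℝ}

lemma hasDerivAt_mul_gaussWeight {q : ℝ → ℝ} {q' z : ℝ} (hq : HasDerivAt q q' z) :
    HasDerivAt (fun z => q z * gaussWeight β z) ((q' - β * z * q z) * gaussWeight β z) z :=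
  (hq.mul (hasDerivAt_gaussWeight β z)).congr_deriv (by ring)

lemma hasDerivAt_locScore (z : ℝ) : HasDerivAt (locScore β) (locScoreDeriv β z) z :=
  (hasDerivAt_mul_gaussWeight (hasDerivAt_id' z)).congr_deriv (by rw [locScoreDeriv]; ring)

lemma hasDerivAt_scaleScore (z : ℝ) : HasDerivAt (scaleScore β) (scaleScoreDeriv β z) z :=
  ((hasDerivAt_mul_gaussWeight ((hasDerivAt_pow 2 z).sub_const 1)).add_const _).congr_deriv
    (by rw [scaleScoreDeriv]; push_cast; ring)

lemma hasDerivAt_locScoreDeriv (z : ℝ) : HasDerivAt (locScoreDeriv β)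
    (β * z * (β * z ^ 2 - 3) * gaussWeight β z) z :=
  (hasDerivAt_mul_gaussWeight (((hasDerivAt_pow 2 z).const_mul β).const_sub 1)).congr_deriv
    (by push_cast; ring)

lemma hasDerivAt_scaleScoreDeriv (z : ℝ) : HasDerivAt (scaleScoreDeriv β)
    ((2 + β - (5 + β) * (β * z ^ 2) + (β * z ^ 2) ^ 2) * gaussWeight β z) z :=
  (hasDerivAt_mul_gaussWeight (((hasDerivAt_id' z).const_mul (2 + β)).fun_sub
    ((hasDerivAt_pow 3 z).const_mul β))).congr_deriv (by push_cast; ring)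

lemma pow_mul_exp_neg_le_factorial {w : ℝ} (hw : 0 ≤ w) (n : ℕ) :
    w ^ n * Real.exp (-w) ≤ n.factorial := by
  rw [Real.exp_neg, ← div_eq_mul_inv, div_le_comm₀ (Real.exp_pos w) (by positivity)]
  exact Real.pow_div_factorial_le_exp w hw n

lemma abs_mul_gaussWeight_le (hβ : 0 ≤ β) {q z c₀ c₁ c₂ : ℝ} (hc₀ : 0 ≤ c₀) (hc₁ : 0 ≤ c₁)
    (hc₂ : 0 ≤ c₂) (hq : |q| ≤ c₀ + c₁ * (β * z ^ 2 / 2) + c₂ * (β * z ^ 2 / 2) ^ 2) :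
    |q * gaussWeight β z| ≤ c₀ + c₁ + 2 * c₂ := by
  have hw : 0 ≤ β * z ^ 2 / 2 := by positivity
  have hpow := pow_mul_exp_neg_le_factorial hw
  rw [abs_mul, abs_of_pos (gaussWeight_pos β z), gaussWeight]
  calc |q| * Real.exp (-(β * z ^ 2 / 2))
    _ ≤ (c₀ + c₁ * (β * z ^ 2 / 2) + c₂ * (β * z ^ 2 / 2) ^ 2) * Real.exp (-(β * z ^ 2 / 2)) := by
      gcongr
    _ ≤ c₀ + c₁ + 2 * c₂ := by
      have h0 := mul_le_mul_of_nonneg_left (hpow 0) hc₀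
      have h1 := mul_le_mul_of_nonneg_left (hpow 1) hc₁
      have h2 := mul_le_mul_of_nonneg_left (hpow 2) hc₂
      norm_num [Nat.factorial] at h0 h1 h2
      linarith

lemma exists_abs_locScore_taylor_remainder_le (hβ : 0 ≤ β) : ∃ C, ∀ z t,
    |locScore β (z + t) - locScore β z - t * locScoreDeriv β z| ≤ C * t ^ 2 := by
  refine ⟨3 * β / 2 + (β + 3) + 2 * 2, abs_taylor_remainder_le hasDerivAt_locScore
    hasDerivAt_locScoreDeriv fun z => abs_mul_gaussWeight_le hβ (by positivity) (by positivity)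
    zero_le_two ?_⟩
  have hz : |β * z| ≤ β / 2 + β * z ^ 2 / 2 := by
    rw [abs_mul, abs_of_nonneg hβ, ← sq_abs z]
    nlinarith [mul_nonneg hβ (sq_nonneg (|z| - 1))]
  have hw : 0 ≤ β * z ^ 2 := by positivity
  calc |β * z * (β * z ^ 2 - 3)| = |β * z| * |β * z ^ 2 - 3| := abs_mul _ _
    _ ≤ (β / 2 + β * z ^ 2 / 2) * (β * z ^ 2 + 3) :=
      mul_le_mul hz (abs_le.2 ⟨by linarith, by linarith⟩) (abs_nonneg _) (by positivity)
    _ = 3 * β / 2 + (β + 3) * (β * z ^ 2 / 2) + 2 * (β * z ^ 2 / 2) ^ 2 := by ring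

lemma exists_abs_scaleScore_taylor_remainder_le (hβ : 0 ≤ β) : ∃ C, ∀ z t,
    |scaleScore β (z + t) - scaleScore β z - t * scaleScoreDeriv β z| ≤ C * t ^ 2 := by
  refine ⟨2 + β + 2 * (5 + β) + 2 * 4, abs_taylor_remainder_le hasDerivAt_scaleScore
    hasDerivAt_scaleScoreDeriv fun z => abs_mul_gaussWeight_le hβ (by positivity) (by positivity)
    zero_le_four (abs_le.2 ?_)⟩
  have hw : 0 ≤ (5 + β) * (β * z ^ 2) := by positivity
  constructor <;> nlinarith [sq_nonneg (β * z ^ 2)]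

end Taylor

section ScoreMoments

variable {β : ℝ}

@[fun_prop]
lemma measurable_locScore : Measurable (locScore β) := by unfold locScore; fun_prop

@[fun_prop]
lemma measurable_scaleScore : Measurable (scaleScore β) := by unfold scaleScore; fun_prop

@[fun_prop]
lemma measurable_locScoreDeriv : Measurable (locScoreDeriv β) := by unfold locScoreDeriv; fun_prop

@[fun_prop]
lemma measurable_scaleScoreDeriv : Measurable (scaleScoreDeriv β) := by
  unfold scaleScoreDeriv; fun_prop

lemma integrable_mul_id_locScoreDeriv (hβ : 0 < 1 + β) :
    Integrable (fun z => z * locScoreDeriv β z) (gaussianReal 0 1) :=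
  (integrable_quartic_mul_gaussWeight hβ 0 1 0 (-β) 0).congr <| ae_of_all _ fun z => by
    simp only [locScoreDeriv]; ring

lemma integrable_locScoreDeriv (hβ : 0 < 1 + β) :
    Integrable (locScoreDeriv β) (gaussianReal 0 1) :=
  (integrable_quartic_mul_gaussWeight hβ 1 0 (-β) 0 0).congr <| ae_of_all _ fun z => by
    simp only [locScoreDeriv]; ring

lemma integrable_mul_id_scaleScoreDeriv (hβ : 0 < 1 + β) :
    Integrable (fun z => z * scaleScoreDeriv β z) (gaussianReal 0 1) :=
  (integrable_quartic_mul_gaussWeight hβ 0 0 (2 + β) 0 (-β)).congr <| ae_of_all _ fun z => by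
    simp only [scaleScoreDeriv]; ring

lemma integrable_scaleScoreDeriv (hβ : 0 < 1 + β) :
    Integrable (scaleScoreDeriv β) (gaussianReal 0 1) :=
  (integrable_quartic_mul_gaussWeight hβ 0 (2 + β) 0 (-β) 0).congr <| ae_of_all _ fun z => by
    simp only [scaleScoreDeriv]; ring

lemma integral_quartic_mul_gaussWeight_of_eq (hβ : 0 < 1 + β) {F : ℝ → ℝ} (a₀ a₁ a₂ a₃ a₄ : ℝ)
    (hF : ∀ z, F z = (a₀ + a₁ * z + a₂ * z ^ 2 + a₃ * z ^ 3 + a₄ * z ^ 4) * gaussWeight β z) :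
    ∫ z, F z ∂gaussianReal 0 1 = (a₀ + a₂ / (1 + β) + 3 * a₄ / (1 + β) ^ 2) / √(1 + β) := by
  simp only [hF, integral_quartic_mul_gaussWeight hβ]

lemma integral_mul_id_locScoreDeriv (hβ : 0 < 1 + β) :
    ∫ z, z * locScoreDeriv β z ∂gaussianReal 0 1 = 0 := by
  rw [integral_quartic_mul_gaussWeight_of_eq hβ 0 1 0 (-β) 0
    fun z => by rw [locScoreDeriv]; ring]
  simp

lemma integral_locScoreDeriv (hβ : 0 < 1 + β) :
    ∫ z, locScoreDeriv β z ∂gaussianReal 0 1 = locInfo β := by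
  rw [integral_quartic_mul_gaussWeight_of_eq hβ 1 0 (-β) 0 0
    fun z => by rw [locScoreDeriv]; ring, locInfo]
  field

lemma integral_mul_id_scaleScoreDeriv (hβ : 0 < 1 + β) :
    ∫ z, z * scaleScoreDeriv β z ∂gaussianReal 0 1 = scaleInfo β := by
  rw [integral_quartic_mul_gaussWeight_of_eq hβ 0 0 (2 + β) 0 (-β)
    fun z => by rw [scaleScoreDeriv]; ring, scaleInfo]
  field

lemma integral_scaleScoreDeriv (hβ : 0 < 1 + β) :
    ∫ z, scaleScoreDeriv β z ∂gaussianReal 0 1 = 0 := by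
  rw [integral_quartic_mul_gaussWeight_of_eq hβ 0 (2 + β) 0 (-β) 0
    fun z => by rw [scaleScoreDeriv]; ring]
  simp

lemma integral_locScore (hβ : 0 < 1 + β) : ∫ z, locScore β z ∂gaussianReal 0 1 = 0 := by
  rw [integral_quartic_mul_gaussWeight_of_eq hβ 0 1 0 0 0 fun z => by rw [locScore]; ring]
  simp

lemma integral_scaleScore (hβ : 0 < 1 + β) : ∫ z, scaleScore β z ∂gaussianReal 0 1 = 0 := by
  have hint : Integrable (fun z => (z ^ 2 - 1) * gaussWeight β z) (gaussianReal 0 1) :=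
    (integrable_quartic_mul_gaussWeight hβ (-1) 0 1 0 0).congr (ae_of_all _ fun z => by ring)
  simp only [scaleScore]
  rw [integral_add hint (integrable_const _), integral_quartic_mul_gaussWeight_of_eq hβ (-1) 0 1 0 0
    fun z => by ring]
  simp only [integral_const, probReal_univ, one_smul]
  field

lemma integral_locScore_sq (hβ : 0 < 1 + 2 * β) :
    ∫ z, locScore β z ^ 2 ∂gaussianReal 0 1 = locInfo (2 * β) := by
  rw [integral_quartic_mul_gaussWeight_of_eq hβ 0 0 1 0 0
    fun z => by rw [locScore, mul_pow, gaussWeight_sq]; ring, locInfo]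
  ring

lemma memLp_locScore (hβ : 0 < 1 + 2 * β) : MemLp (locScore β) 2 (gaussianReal 0 1) := by
  refine (memLp_two_iff_integrable_sq measurable_locScore.aestronglyMeasurable).2 <|
    (integrable_quartic_mul_gaussWeight hβ 0 0 1 0 0).congr <| ae_of_all _ fun z => ?_
  simp only [locScore, mul_pow, gaussWeight_sq]
  ring

lemma memLp_scaleScore (hβ : 0 < 1 + 2 * β) : MemLp (scaleScore β) 2 (gaussianReal 0 1) := by
  refine MemLp.add ((memLp_two_iff_integrable_sq (by fun_prop)).2 ?_) (memLp_const _)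
  refine (integrable_quartic_mul_gaussWeight hβ 1 0 (-2) 0 1).congr <| ae_of_all _ fun z => ?_
  simp only [mul_pow, gaussWeight_sq]
  ring

end ScoreMoments

section Linearization

lemma isLittleO_mul_of_tendsto_zero {ι E : Type*} [NormedAddCommGroup E] {l : Filter ι}
    {w u : ι → ℝ} {v : ι → E} (hw : w =O[l] v) (hu : Tendsto u l (𝓝 0)) :
    (fun i => w i * u i) =o[l] v :=
  Asymptotics.isLittleO_norm_right.1 <| by
    simpa only [mul_one] using hw.norm_right.mul_isLittleO ((Asymptotics.isLittleO_one_iff ℝ).2 hu)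

lemma abs_avg_affine_sub_le {h h' : ℝ → ℝ} {C : ℝ} (x : ℕ → ℝ) {n : ℕ} (hn : n ≠ 0) (a b : ℝ)
    (htaylor : ∀ z t, |h (z + t) - h z - t * h' z| ≤ C * t ^ 2) :
    |avg x n (fun z => h (z + (a * z + b))) - avg x n h -
        (a * avg x n (fun z => z * h' z) + b * avg x n h')| ≤
      2 * C * (a ^ 2 * avg x n (fun z => z ^ 2) + b ^ 2) := by
  have hC : 0 ≤ C := by simpa using (abs_nonneg _).trans (htaylor 0 1)
  have hrem (z : ℝ) : |h (z + (a * z + b)) - h z - (a * (z * h' z) + b * h' z)| ≤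
      2 * C * (a ^ 2 * z ^ 2 + b ^ 2) := by
    rw [← mul_assoc, ← add_mul]
    nlinarith [htaylor z (a * z + b), mul_nonneg hC (sq_nonneg (a * z - b))]
  simpa only [avg_sub, avg_add, avg_const_mul, avg_const x hn] using abs_avg_le x n hrem

variable {Ω : Type*} [MeasurableSpace Ω] {P : Measure Ω} [IsFiniteMeasure P] {Z : ℕ → Ω → ℝ}
  {a b : ℕ × Ω → ℝ} {β : ℝ}

lemma IsIIDSample.isLittleO_avg_add {ν : Measure ℝ} {h h' : ℝ → ℝ} {C : ℝ}
    (hZ : IsIIDSample Z ν P) (hsq : Integrable (fun z => z ^ 2) ν) (hmeas : Measurable h')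
    (hint : Integrable h' ν) (hint_mul : Integrable (fun z => z * h' z) ν)
    (htaylor : ∀ z t, |h (z + t) - h z - t * h' z| ≤ C * t ^ 2)
    (ha : Tendsto a (inProb P atTop) (𝓝 0)) (hb : Tendsto b (inProb P atTop) (𝓝 0))
    (hroot : ∀ᶠ p in inProb P atTop,
      avg (fun k => Z k p.2) p.1 (fun z => h (z + (a p * z + b p))) = 0) :
    (fun p => avg (fun k => Z k p.2) p.1 h +
        (a p * ∫ z, z * h' z ∂ν + b p * ∫ z, h' z ∂ν)) =o[inProb P atTop]
      fun p => (a p, b p) := by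
  have haO : a =O[inProb P atTop] fun p => (a p, b p) := Asymptotics.isBigO_fst_prod
  have hbO : b =O[inProb P atTop] fun p => (a p, b p) := Asymptotics.isBigO_snd_prod
  have hlln_sq := hZ.tendsto_avg (by fun_prop) hsq
  have hlln := hZ.tendsto_avg hmeas hint
  have hlln_mul := hZ.tendsto_avg (g := fun z => z * h' z) (by fun_prop) hint_mul
  have hquad : (fun p => 2 * C * (a p ^ 2 * avg (fun k => Z k p.2) p.1 (fun z => z ^ 2) + b p ^ 2))
      =o[inProb P atTop] fun p => (a p, b p) := by
    have hsq_a := isLittleO_mul_of_tendsto_zero haO (by simpa using ha.mul hlln_sq)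
    have hsq_b := isLittleO_mul_of_tendsto_zero hbO hb
    refine ((hsq_a.add hsq_b).const_mul_left (2 * C)).congr_left fun p => ?_
    ring
  have hrem : (fun p => avg (fun k => Z k p.2) p.1 h +
      (a p * avg (fun k => Z k p.2) p.1 (fun z => z * h' z) +
        b p * avg (fun k => Z k p.2) p.1 h')) =o[inProb P atTop] fun p => (a p, b p) := by
    refine Asymptotics.IsBigO.trans_isLittleO (Asymptotics.IsBigO.of_bound 1 ?_) hquad
    filter_upwards [hroot, tendsto_fst_inProb.eventually (eventually_ne_atTop 0)] with p hp hn
    have hbound := abs_avg_affine_sub_le (fun k => Z k p.2) hn (a p) (b p) htaylor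
    rw [hp, zero_sub, ← neg_add', abs_neg] at hbound
    rw [one_mul]
    exact hbound.trans (le_abs_self _)
  have herr_mul := isLittleO_mul_of_tendsto_zero haO
    (by simpa using hlln_mul.sub_const (∫ z, z * h' z ∂ν))
  have herr := isLittleO_mul_of_tendsto_zero hbO
    (by simpa using hlln.sub_const (∫ z, h' z ∂ν))
  refine ((hrem.sub herr_mul).sub herr).congr_left fun p => ?_
  ring

lemma IsIIDSample.isLittleO_avg_locScore (hZ : IsIIDSample Z (gaussianReal 0 1) P) (hβ : 0 ≤ β)
    (ha : Tendsto a (inProb P atTop) (𝓝 0)) (hb : Tendsto b (inProb P atTop) (𝓝 0))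
    (hroot : ∀ᶠ p in inProb P atTop,
      avg (fun k => Z k p.2) p.1 (fun z => locScore β (z + (a p * z + b p))) = 0) :
    (fun p => avg (fun k => Z k p.2) p.1 (locScore β) + b p * locInfo β) =o[inProb P atTop]
      fun p => (a p, b p) := by
  have hβ₁ : 0 < 1 + β := by linarith
  obtain ⟨C, hC⟩ := exists_abs_locScore_taylor_remainder_le hβ
  simpa only [integral_mul_id_locScoreDeriv hβ₁, integral_locScoreDeriv hβ₁, mul_zero, zero_add]
    using hZ.isLittleO_avg_add (memLp_id_gaussianReal 2).integrable_sq measurable_locScoreDeriv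
      (integrable_locScoreDeriv hβ₁) (integrable_mul_id_locScoreDeriv hβ₁) hC ha hb hroot

lemma IsIIDSample.isLittleO_avg_scaleScore (hZ : IsIIDSample Z (gaussianReal 0 1) P) (hβ : 0 ≤ β)
    (ha : Tendsto a (inProb P atTop) (𝓝 0)) (hb : Tendsto b (inProb P atTop) (𝓝 0))
    (hroot : ∀ᶠ p in inProb P atTop,
      avg (fun k => Z k p.2) p.1 (fun z => scaleScore β (z + (a p * z + b p))) = 0) :
    (fun p => avg (fun k => Z k p.2) p.1 (scaleScore β) + a p * scaleInfo β) =o[inProb P atTop]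
      fun p => (a p, b p) := by
  have hβ₁ : 0 < 1 + β := by linarith
  obtain ⟨C, hC⟩ := exists_abs_scaleScore_taylor_remainder_le hβ
  simpa only [integral_mul_id_scaleScoreDeriv hβ₁, integral_scaleScoreDeriv hβ₁, mul_zero, add_zero]
    using hZ.isLittleO_avg_add (memLp_id_gaussianReal 2).integrable_sq measurable_scaleScoreDeriv
      (integrable_scaleScoreDeriv hβ₁) (integrable_mul_id_scaleScoreDeriv hβ₁) hC ha hb hroot

end Linearization

section DivergenceExpansion

lemma isBigO_sq_of_contDiffAt {f : ℝ → ℝ} {a : ℝ} (hf : ContDiffAt ℝ 2 f a) (h0 : f a = 0)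
    (h1 : deriv f a = 0) : f =O[𝓝 a] fun x => (x - a) ^ 2 := by
  have hderiv : ∀ᶠ x in 𝓝 a, HasDerivAt f (deriv f x) x :=
    ((hf.of_le one_le_two).eventually (by simp)).mono
      fun x hx => (hx.differentiableAt (by simp)).hasDerivAt
  have hf' : ContDiffAt ℝ 1 (deriv f) a :=
    (hf.fderiv_right (m := 1) (by norm_num)).clm_apply contDiffAt_const
  have hO : deriv f =O[𝓝 a] fun x => x - a := by
    simpa [h1] using (hf'.differentiableAt (by simp)).hasDerivAt.isBigO_sub
  obtain ⟨C, hC0, hC⟩ := hO.exists_pos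
  obtain ⟨ε, hε, hball⟩ := Metric.eventually_nhds_iff_ball.1 (hderiv.and hC.bound)
  refine Asymptotics.IsBigO.of_bound C ?_
  filter_upwards [Metric.ball_mem_nhds a hε] with x hx
  have hseg : ∀ y ∈ segment ℝ a x, y ∈ Metric.ball a ε := fun y hy =>
    (convex_ball a ε).segment_subset (Metric.mem_ball_self hε) hx hy
  have hmvt := (convex_segment a x).norm_image_sub_le_of_norm_hasDerivWithin_le
    (f := f) (f' := deriv f) (C := C * ‖x - a‖)
    (fun y hy => (hball y (hseg y hy)).1.hasDerivWithinAt)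
    (fun y hy => (hball y (hseg y hy)).2.trans (by
      gcongr ?_ * ?_
      exact norm_sub_le_of_mem_segment hy))
    (left_mem_segment ℝ a x) (right_mem_segment ℝ a x)
  simpa [h0, sq, mul_assoc] using hmvt

lemma isBigO_log_remainder :
    (fun r : ℝ => r ^ 2 - 1 - 2 * Real.log r) =O[𝓝 1] fun r => (r - 1) ^ 2 := by
  refine isBigO_sq_of_contDiffAt ?_ (by simp) (HasDerivAt.deriv ?_)
  · exact ((contDiffAt_id.pow 2).sub contDiffAt_const).sub
      (contDiffAt_const.mul (Real.contDiffAt_log.2 one_ne_zero))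
  · convert! (((hasDerivAt_id (1 : ℝ)).pow 2).sub_const 1).sub
      ((Real.hasDerivAt_log one_ne_zero).const_mul 2) using 1
    norm_num

lemma isBigO_scale_remainder {γ : ℝ} (hγ : 0 < γ) :
    (fun r : ℝ => (1 + 1 / γ * r ^ (-γ)) / √(1 + γ) - (1 + 1 / γ) / √(1 + γ * r ^ 2))
      =O[𝓝 1] fun r => (r - 1) ^ 2 := by
  have hγ1 : 1 + γ * (1 : ℝ) ^ 2 ≠ 0 := by nlinarith
  refine isBigO_sq_of_contDiffAt ?_ ?_ (HasDerivAt.deriv ?_)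
  · refine ContDiffAt.sub ?_ (contDiffAt_const.div ?_ (by positivity))
    · exact (contDiffAt_const.add (contDiffAt_const.mul
        (contDiffAt_id.rpow_const_of_ne one_ne_zero))).div_const _
    · exact (contDiffAt_const.add (contDiffAt_const.mul (contDiffAt_id.pow 2))).sqrt hγ1
  · simp
  · have hrpow : HasDerivAt (fun r : ℝ => r ^ (-γ)) (-γ) 1 := by
      simpa using Real.hasDerivAt_rpow_const (x := 1) (p := -γ) (Or.inl one_ne_zero)
    have hsqrt : HasDerivAt (fun r : ℝ => √(1 + γ * r ^ 2)) (γ / √(1 + γ)) 1 := by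
      refine (((hasDerivAt_pow 2 (1 : ℝ)).const_mul γ).const_add 1).sqrt hγ1 |>.congr_deriv ?_
      norm_num
      ring
    convert! (((hrpow.const_mul (1 / γ)).const_add 1).div_const √(1 + γ)).sub
      ((hsqrt.fun_inv (Real.sqrt_ne_zero'.2 (by positivity))).const_mul (1 + 1 / γ)) using 1
    rw [one_pow, mul_one, Real.sq_sqrt (by positivity)]
    field_simp
    ring

variable {ι E : Type*} {l : Filter ι} [NormedAddCommGroup E] {u : ι → E}

lemma isLittleO_one_sub_gaussWeight {c δ : ι → ℝ} {c₀ : ℝ} (hc : Tendsto c l (𝓝 c₀))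
    (hδ : Tendsto δ l (𝓝 0)) :
    (fun i => 1 - gaussWeight (c i) (δ i) - c i * δ i ^ 2 / 2) =o[l] fun i => δ i ^ 2 := by
  have hexp : (fun x => Real.exp x - 1 - x) =o[𝓝 0] fun x : ℝ => x := by
    simpa using (Real.hasDerivAt_exp 0).isLittleO
  have harg : Tendsto (fun i => -(c i * δ i ^ 2 / 2)) l (𝓝 0) := by
    simpa using ((hc.mul (hδ.pow 2)).div_const 2).neg
  have hO : (fun i => -(c i * δ i ^ 2 / 2)) =O[l] fun i => δ i ^ 2 := by
    refine ((hc.isBigO_one ℝ).mul (Asymptotics.isBigO_refl (fun i => δ i ^ 2) l)).const_mul_left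
      (-(1 / 2)) |>.congr (fun i => by ring) fun i => one_mul _
  refine ((hexp.comp_tendsto harg).trans_isBigO hO).neg_left.congr_left fun i => ?_
  simp only [Function.comp_apply, gaussWeight]
  ring

variable {θ θ' : ι → Fin 2 → ℝ} {θ₀ : Fin 2 → ℝ}

lemma tendsto_scaleRatio (hθ₀ : 0 < θ₀ 1) (hθ : Tendsto θ l (𝓝 θ₀)) (hθ' : Tendsto θ' l (𝓝 θ₀)) :
    Tendsto (fun i => θ i 1 / θ' i 1) l (𝓝 1) := by
  rw [← div_self hθ₀.ne']
  exact (tendsto_pi_nhds.1 hθ 1).div (tendsto_pi_nhds.1 hθ' 1) hθ₀.ne'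

lemma tendsto_locDiff (hθ₀ : 0 < θ₀ 1) (hθ : Tendsto θ l (𝓝 θ₀)) (hθ' : Tendsto θ' l (𝓝 θ₀)) :
    Tendsto (fun i => (θ i 0 - θ' i 0) / θ' i 1) l (𝓝 0) := by
  rw [← zero_div (θ₀ 1), ← sub_self (θ₀ 0)]
  exact ((tendsto_pi_nhds.1 hθ 0).sub (tendsto_pi_nhds.1 hθ' 0)).div (tendsto_pi_nhds.1 hθ' 1)
    hθ₀.ne'

lemma isLittleO_divergence_zero (hθ₀ : 0 < θ₀ 1) (hθ : Tendsto θ l (𝓝 θ₀))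
    (hθ' : Tendsto θ' l (𝓝 θ₀)) (hratio : (fun i => θ i 1 / θ' i 1 - 1) =o[l] u) :
    (fun i => 2 * divergence 0 (normalModel (θ i)) (normalModel (θ' i)) -
      ((θ i 0 - θ' i 0) / θ' i 1) ^ 2) =o[l] fun i => ‖u i‖ ^ 2 := by
  refine ((isBigO_log_remainder.comp_tendsto (tendsto_scaleRatio hθ₀ hθ hθ')).trans_isLittleO
    (hratio.norm_right.pow two_pos)).congr' ?_ .rfl
  filter_upwards [(tendsto_pi_nhds.1 hθ 1).eventually_const_lt hθ₀,
    (tendsto_pi_nhds.1 hθ' 1).eventually_const_lt hθ₀] with i hi hi'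
  rw [divergence_zero_normalModel hi hi', Function.comp_apply]
  ring

lemma isLittleO_divergence_of_pos {γ : ℝ} (hγ : 0 < γ) (hθ₀ : 0 < θ₀ 1) (hθ : Tendsto θ l (𝓝 θ₀))
    (hθ' : Tendsto θ' l (𝓝 θ₀)) (hratio : (fun i => θ i 1 / θ' i 1 - 1) =o[l] u)
    (hloc : (fun i => (θ i 0 - θ' i 0) / θ' i 1) =O[l] u) :
    (fun i => 2 * divergence γ (normalModel (θ i)) (normalModel (θ' i)) -
      normalPeak (θ₀ 1) ^ γ / √(1 + γ) * ((θ i 0 - θ' i 0) / θ' i 1) ^ 2)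
      =o[l] fun i => ‖u i‖ ^ 2 := by
  set r := fun i => θ i 1 / θ' i 1
  set δ := fun i => (θ i 0 - θ' i 0) / θ' i 1
  set A := fun i => normalPeak (θ' i 1) ^ γ
  set B := fun i => (1 + 1 / γ) / √(1 + γ * r i ^ 2)
  set c := fun i => γ / (1 + γ * r i ^ 2)
  set κ := normalPeak (θ₀ 1) ^ γ / √(1 + γ)
  have hr : Tendsto r l (𝓝 1) := tendsto_scaleRatio hθ₀ hθ hθ'
  have hγr : Tendsto (fun i => 1 + γ * r i ^ 2) l (𝓝 (1 + γ)) := by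
    simpa using ((hr.pow 2).const_mul γ).const_add 1
  have hA : Tendsto A l (𝓝 (normalPeak (θ₀ 1) ^ γ)) :=
    (hasDerivAt_normalPeak_rpow hθ₀ γ).continuousAt.tendsto.comp (tendsto_pi_nhds.1 hθ' 1)
  have hB : Tendsto B l (𝓝 ((1 + 1 / γ) / √(1 + γ))) :=
    tendsto_const_nhds.div hγr.sqrt (by positivity)
  have hc : Tendsto c l (𝓝 (γ / (1 + γ))) := tendsto_const_nhds.div hγr (by positivity)
  have hκ : Tendsto (fun i => A i * B i * c i - κ) l (𝓝 0) := by
    convert ((hA.mul hB).mul hc).sub_const κ using 2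
    simp only [κ]
    field_simp
    ring
  have hδ : (fun i => δ i ^ 2) =O[l] fun i => ‖u i‖ ^ 2 := hloc.norm_right.pow 2
  have hscale : (fun i => (1 + 1 / γ * r i ^ (-γ)) / √(1 + γ) - B i) =o[l] fun i => ‖u i‖ ^ 2 :=
    ((isBigO_scale_remainder hγ).comp_tendsto hr).trans_isLittleO (hratio.norm_right.pow two_pos)
  have hexp := (isLittleO_one_sub_gaussWeight hc (tendsto_locDiff hθ₀ hθ hθ')).trans_isBigO hδ
  have hsum := (((hA.isBigO_one ℝ).mul_isLittleO hscale).add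
    (((hA.mul hB).isBigO_one ℝ).mul_isLittleO hexp)).const_mul_left 2
  simp only [one_mul] at hsum
  refine (hsum.add (isLittleO_mul_of_tendsto_zero hδ hκ)).congr' ?_ .rfl
  filter_upwards [(tendsto_pi_nhds.1 hθ 1).eventually_const_lt hθ₀,
    (tendsto_pi_nhds.1 hθ' 1).eventually_const_lt hθ₀] with i hi hi'
  rw [divergence_normalModel hi hi' hγ]
  simp only [A, B, c, δ, r]
  ring

lemma isLittleO_divergence {γ : ℝ} (hγ : 0 ≤ γ) (hθ₀ : 0 < θ₀ 1) (hθ : Tendsto θ l (𝓝 θ₀))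
    (hθ' : Tendsto θ' l (𝓝 θ₀)) (hratio : (fun i => θ i 1 / θ' i 1 - 1) =o[l] u)
    (hloc : (fun i => (θ i 0 - θ' i 0) / θ' i 1) =O[l] u) :
    (fun i => 2 * divergence γ (normalModel (θ i)) (normalModel (θ' i)) -
      normalPeak (θ₀ 1) ^ γ / √(1 + γ) * ((θ i 0 - θ' i 0) / θ' i 1) ^ 2)
      =o[l] fun i => ‖u i‖ ^ 2 := by
  rcases hγ.eq_or_lt with rfl | hγ
  · simpa using isLittleO_divergence_zero hθ₀ hθ hθ' hratio
  · exact isLittleO_divergence_of_pos hγ hθ₀ hθ hθ' hratio hloc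

end DivergenceExpansion

section TestStatistic

/-- The scale part `a` of the affine map `z ↦ z + (a * z + b)` that turns observations standardized
with `θ₀` into observations standardized with `θ`. -/
def scaleError (θ₀ θ : Fin 2 → ℝ) : ℝ := θ₀ 1 / θ 1 - 1

/-- The location part `b` of the affine map `z ↦ z + (a * z + b)` that turns observations
standardized with `θ₀` into observations standardized with `θ`. -/
def locError (θ₀ θ : Fin 2 → ℝ) : ℝ := (θ₀ 0 - θ 0) / θ 1

/-- The averages of `locScore β` and `scaleScore β` over the observations standardized with the true
parameter `θ₀`, as a function of the sample size and the outcome. -/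
def scoreAvg {Ω : Type*} (β : ℝ) (θ₀ : Fin 2 → ℝ) (X : ℕ → Ω → ℝ) (p : ℕ × Ω) : ℝ × ℝ :=
  (avg (fun k => (X k p.2 - θ₀ 0) / θ₀ 1) p.1 (locScore β),
    avg (fun k => (X k p.2 - θ₀ 0) / θ₀ 1) p.1 (scaleScore β))

section ParameterErrors

variable {ι : Type*} {l : Filter ι} {θ θ' : ι → Fin 2 → ℝ} {θ₀ : Fin 2 → ℝ}

lemma avg_comp_standardize_eq_avg_errors (x : ℕ → ℝ) (n : ℕ) (g : ℝ → ℝ) (hθ₀ : θ₀ 1 ≠ 0)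
    (θ : Fin 2 → ℝ) :
    avg x n (fun y => g ((y - θ 0) / θ 1)) =
      avg (fun k => (x k - θ₀ 0) / θ₀ 1) n
        (fun z => g (z + (scaleError θ₀ θ * z + locError θ₀ θ))) := by
  have hz (y : ℝ) : (y - θ 0) / θ 1 = (y - θ₀ 0) / θ₀ 1 +
      (scaleError θ₀ θ * ((y - θ₀ 0) / θ₀ 1) + locError θ₀ θ) := by
    rw [scaleError, locError]
    field_simp
    ring
  simp only [avg, hz]

lemma tendsto_scaleError (hθ₀ : 0 < θ₀ 1) (hθ : Tendsto θ l (𝓝 θ₀)) :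
    Tendsto (fun i => scaleError θ₀ (θ i)) l (𝓝 0) := by
  simpa only [sub_self] using! (tendsto_scaleRatio hθ₀ tendsto_const_nhds hθ).sub_const 1

lemma tendsto_locError (hθ₀ : 0 < θ₀ 1) (hθ : Tendsto θ l (𝓝 θ₀)) :
    Tendsto (fun i => locError θ₀ (θ i)) l (𝓝 0) :=
  tendsto_locDiff hθ₀ tendsto_const_nhds hθ

lemma isLittleO_scaleRatio_sub_one {E : Type*} [NormedAddCommGroup E] {u : ι → E}
    (hθ₀ : 0 < θ₀ 1) (hθ : Tendsto θ l (𝓝 θ₀))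
    (h : (fun i => scaleError θ₀ (θ' i) - scaleError θ₀ (θ i)) =o[l] u) :
    (fun i => θ i 1 / θ' i 1 - 1) =o[l] u := by
  have hlim : (fun i => θ i 1 / θ₀ 1) =O[l] fun _ => (1 : ℝ) :=
    (tendsto_scaleRatio hθ₀ hθ tendsto_const_nhds).isBigO_one ℝ
  refine (hlim.mul_isLittleO h.norm_right).congr' ?_ (by simp) |>.of_norm_right
  filter_upwards [(tendsto_pi_nhds.1 hθ 1).eventually_const_lt hθ₀] with i hi
  rw [scaleError, scaleError]
  field_simp
  ring

end ParameterErrors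

lemma isBigO_self_mul_const {ι : Type*} {l : Filter ι} {w : ι → ℝ} {c : ℝ} (hc : c ≠ 0) :
    w =O[l] fun i => w i * c := by
  simpa only [mul_comm c] using Asymptotics.isBigO_self_const_mul hc w l

lemma isBigO_of_isLittleO_add {ι E F : Type*} [SeminormedAddCommGroup E] [Norm F] {l : Filter ι}
    {S w : ι → E} {v : ι → F} (h : (fun i => S i + w i) =o[l] v) (hw : v =O[l] w) : v =O[l] S := by
  refine hw.trans ((h.trans_isBigO hw).right_isBigO_sub.trans ?_)
  simpa using Asymptotics.isBigO_refl S l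

variable {Ω : Type*} [MeasurableSpace Ω] {P : Measure Ω} {X : ℕ → Ω → ℝ}
  {est est₀ : ℕ → Ω → Fin 2 → ℝ} {θ₀ : Fin 2 → ℝ} {β γ : ℝ}

lemma norm_sq_le_fst_sq_add_snd_sq (x : ℝ × ℝ) : ‖x‖ ^ 2 ≤ x.1 ^ 2 + x.2 ^ 2 := by
  rw [Prod.norm_def]
  rcases max_choice ‖x.1‖ ‖x.2‖ with h | h <;> rw [h, Real.norm_eq_abs, sq_abs]
  · exact le_add_of_nonneg_right (sq_nonneg _)
  · exact le_add_of_nonneg_left (sq_nonneg _)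

lemma IsIIDSample.integrable_scoreAvg_sq
    (hX : IsIIDSample X (gaussianReal (θ₀ 0) (θ₀ 1 ^ 2).toNNReal) P) (hθ₀ : 0 < θ₀ 1)
    (hβ : 0 < 1 + 2 * β) (n : ℕ) :
    Integrable (fun ω => (scoreAvg β θ₀ X (n, ω)).1 ^ 2 + (scoreAvg β θ₀ X (n, ω)).2 ^ 2) P :=
  ((hX.standardize hθ₀).memLp_avg (memLp_locScore hβ) n).integrable_sq.add
    ((hX.standardize hθ₀).memLp_avg (memLp_scaleScore hβ) n).integrable_sq

section FiniteMeasure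

variable [IsFiniteMeasure P]

lemma IsMDPDE.isLittleO_scoreAvg_add (hest : IsMDPDE P β normalModel normalSpace θ₀ X est)
    (hX : IsIIDSample X (gaussianReal (θ₀ 0) (θ₀ 1 ^ 2).toNNReal) P) (hθ₀ : 0 < θ₀ 1)
    (hβ : 0 ≤ β) :
    (fun p => scoreAvg β θ₀ X p + (locError θ₀ (est p.1 p.2) * locInfo β,
      scaleError θ₀ (est p.1 p.2) * scaleInfo β)) =o[inProb P atTop] scoreAvg β θ₀ X := by
  have hβ₁ : 0 < 1 + β := by linarith
  have hlim := hest.tendsto hX hθ₀ hβ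
  have ha := tendsto_scaleError hθ₀ hlim
  have hb := tendsto_locError hθ₀ hlim
  have hroot := hest.eventually_avg_eq_zero hX hθ₀ hβ
  simp only [avg_comp_standardize_eq_avg_errors _ _ _ hθ₀.ne'] at hroot
  have hloc := (hX.standardize hθ₀).isLittleO_avg_locScore hβ ha hb (hroot.mono fun _ h => h.1)
  have hscale := (hX.standardize hθ₀).isLittleO_avg_scaleScore hβ ha hb
    (hroot.mono fun _ h => h.2)
  have hsum : (fun p => scoreAvg β θ₀ X p + (locError θ₀ (est p.1 p.2) * locInfo β,
      scaleError θ₀ (est p.1 p.2) * scaleInfo β)) =o[inProb P atTop]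
        fun p => (scaleError θ₀ (est p.1 p.2), locError θ₀ (est p.1 p.2)) :=
    hloc.prod_left hscale
  refine hsum.trans_isBigO (isBigO_of_isLittleO_add hsum (.prod_left ?_ ?_))
  · exact (isBigO_self_mul_const (scaleInfo_pos hβ₁).ne').trans Asymptotics.isBigO_snd_prod
  · exact (isBigO_self_mul_const (locInfo_pos hβ₁).ne').trans Asymptotics.isBigO_fst_prod

lemma IsRMDPDE.isLittleO_scoreAvg_snd_add
    (hest : IsRMDPDE P β normalModel normalSpace (normalNull (θ₀ 0)) θ₀ X est)
    (hX : IsIIDSample X (gaussianReal (θ₀ 0) (θ₀ 1 ^ 2).toNNReal) P) (hθ₀ : 0 < θ₀ 1)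
    (hβ : 0 ≤ β) :
    (fun p => (scoreAvg β θ₀ X p).2 + scaleError θ₀ (est p.1 p.2) * scaleInfo β)
      =o[inProb P atTop] fun p => (scoreAvg β θ₀ X p).2 := by
  have hβ₁ : 0 < 1 + β := by linarith
  have ha := tendsto_scaleError hθ₀ (hest.tendsto hX hθ₀ hβ)
  have hroot : ∀ᶠ p in inProb P atTop, avg (fun k => (X k p.2 - θ₀ 0) / θ₀ 1) p.1
      (fun z => scaleScore β (z + (scaleError θ₀ (est p.1 p.2) * z + 0))) = 0 := by
    filter_upwards [hest.eventually_avg_eq_zero hX hθ₀ hβ] with p ⟨hloc, havg⟩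
    rw [avg_comp_standardize_eq_avg_errors _ _ _ hθ₀.ne'] at havg
    simpa [locError, hloc] using havg
  have hscale := (hX.standardize hθ₀).isLittleO_avg_scaleScore hβ ha tendsto_const_nhds hroot
  have hsum := hscale.trans_isBigO ((Asymptotics.isBigO_refl _ _).prod_left
    (Asymptotics.isBigO_zero _ _))
  exact hsum.trans_isBigO
    (isBigO_of_isLittleO_add hsum (isBigO_self_mul_const (scaleInfo_pos hβ₁).ne'))

lemma isLittleO_estimatorRatio_sub_one (hest : IsMDPDE P β normalModel normalSpace θ₀ X est)
    (hest₀ : IsRMDPDE P β normalModel normalSpace (normalNull (θ₀ 0)) θ₀ X est₀)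
    (hX : IsIIDSample X (gaussianReal (θ₀ 0) (θ₀ 1 ^ 2).toNNReal) P) (hθ₀ : 0 < θ₀ 1)
    (hβ : 0 ≤ β) :
    (fun p => est p.1 p.2 1 / est₀ p.1 p.2 1 - 1) =o[inProb P atTop] scoreAvg β θ₀ X := by
  have hinfo : scaleInfo β ≠ 0 := (scaleInfo_pos (by linarith)).ne'
  have h := Asymptotics.isBigO_snd_prod'.trans_isLittleO (hest.isLittleO_scoreAvg_add hX hθ₀ hβ)
  have h₀ := (hest₀.isLittleO_scoreAvg_snd_add hX hθ₀ hβ).trans_isBigO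
    (Asymptotics.isBigO_snd_prod' (f' := scoreAvg β θ₀ X))
  refine isLittleO_scaleRatio_sub_one hθ₀ (hest.tendsto hX hθ₀ hβ)
    (((h₀.sub h).const_mul_left (scaleInfo β)⁻¹).congr_left fun p => ?_)
  rw [Prod.snd_add]
  field_simp
  ring

lemma isLittleO_estimatorLocDiff_sub (hest : IsMDPDE P β normalModel normalSpace θ₀ X est)
    (hest₀ : IsRMDPDE P β normalModel normalSpace (normalNull (θ₀ 0)) θ₀ X est₀)
    (hX : IsIIDSample X (gaussianReal (θ₀ 0) (θ₀ 1 ^ 2).toNNReal) P) (hθ₀ : 0 < θ₀ 1)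
    (hβ : 0 ≤ β) :
    (fun p => (est p.1 p.2 0 - est₀ p.1 p.2 0) / est₀ p.1 p.2 1 -
      (scoreAvg β θ₀ X p).1 / locInfo β) =o[inProb P atTop] scoreAvg β θ₀ X := by
  have hinfo : locInfo β ≠ 0 := (locInfo_pos (by linarith)).ne'
  have hlim := hest.tendsto hX hθ₀ hβ
  have h := Asymptotics.isBigO_fst_prod'.trans_isLittleO (hest.isLittleO_scoreAvg_add hX hθ₀ hβ)
  have hratio := isLittleO_estimatorRatio_sub_one hest hest₀ hX hθ₀ hβ
  have hprod := ((tendsto_locError hθ₀ hlim).isBigO_one ℝ).mul_isLittleO hratio.norm_right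
  simp only [one_mul] at hprod
  refine (hprod.of_norm_right.neg_left.sub (h.const_mul_left (locInfo β)⁻¹)).congr' ?_ .rfl
  filter_upwards [(tendsto_pi_nhds.1 hlim 1).eventually_const_lt hθ₀,
    hest₀.eventually_avg_eq_zero hX hθ₀ hβ] with p hp hp₀
  rw [Prod.fst_add, hp₀.1, locError]
  field_simp
  ring

lemma isLittleO_two_mul_divergence_sub (hest : IsMDPDE P β normalModel normalSpace θ₀ X est)
    (hest₀ : IsRMDPDE P β normalModel normalSpace (normalNull (θ₀ 0)) θ₀ X est₀)
    (hX : IsIIDSample X (gaussianReal (θ₀ 0) (θ₀ 1 ^ 2).toNNReal) P) (hθ₀ : 0 < θ₀ 1)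
    (hβ : 0 ≤ β) (hγ : 0 ≤ γ) :
    (fun p => 2 * divergence γ (normalModel (est p.1 p.2)) (normalModel (est₀ p.1 p.2)) -
      normalPeak (θ₀ 1) ^ γ / √(1 + γ) * ((scoreAvg β θ₀ X p).1 / locInfo β) ^ 2)
      =o[inProb P atTop] fun p => ‖scoreAvg β θ₀ X p‖ ^ 2 := by
  have hdiff := isLittleO_estimatorLocDiff_sub hest hest₀ hX hθ₀ hβ
  have hmain : (fun p => (scoreAvg β θ₀ X p).1 / locInfo β) =O[inProb P atTop]
      scoreAvg β θ₀ X := by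
    simpa only [div_eq_inv_mul] using Asymptotics.isBigO_fst_prod'.const_mul_left (locInfo β)⁻¹
  have hloc := (hdiff.isBigO.add hmain).congr_left fun p => sub_add_cancel _ _
  have hdiv := isLittleO_divergence hγ hθ₀ (hest.tendsto hX hθ₀ hβ) (hest₀.tendsto hX hθ₀ hβ)
    (isLittleO_estimatorRatio_sub_one hest hest₀ hX hθ₀ hβ) hloc
  have hsq := hdiff.norm_right.mul_isBigO (hloc.add hmain).norm_right
  refine (hdiv.add ((hsq.congr_right fun p => (sq _).symm).const_mul_left
    (normalPeak (θ₀ 1) ^ γ / √(1 + γ)))).congr_left fun p => ?_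
  ring

lemma IsIIDSample.mul_integral_scoreAvg_sq_le
    (hX : IsIIDSample X (gaussianReal (θ₀ 0) (θ₀ 1 ^ 2).toNNReal) P) (hθ₀ : 0 < θ₀ 1)
    (hβ₁ : 0 < 1 + β) (hβ₂ : 0 < 1 + 2 * β) (n : ℕ) :
    n * ∫ ω, ((scoreAvg β θ₀ X (n, ω)).1 ^ 2 + (scoreAvg β θ₀ X (n, ω)).2 ^ 2) ∂P ≤
      ∫ z, locScore β z ^ 2 ∂gaussianReal 0 1 + ∫ z, scaleScore β z ^ 2 ∂gaussianReal 0 1 := by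
  have hZ := hX.standardize hθ₀
  simp only [scoreAvg]
  rw [integral_add (hZ.memLp_avg (memLp_locScore hβ₂) n).integrable_sq
    (hZ.memLp_avg (memLp_scaleScore hβ₂) n).integrable_sq, mul_add]
  exact add_le_add
    (hZ.mul_integral_avg_sq_le measurable_locScore (memLp_locScore hβ₂) (integral_locScore hβ₁) n)
    (hZ.mul_integral_avg_sq_le measurable_scaleScore (memLp_scaleScore hβ₂)
      (integral_scaleScore hβ₁) n)

lemma tendsto_testStat_sub (hest : IsMDPDE P β normalModel normalSpace θ₀ X est)
    (hest₀ : IsRMDPDE P β normalModel normalSpace (normalNull (θ₀ 0)) θ₀ X est₀)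
    (hX : IsIIDSample X (gaussianReal (θ₀ 0) (θ₀ 1 ^ 2).toNNReal) P) (hθ₀ : 0 < θ₀ 1)
    (hβ : 0 ≤ β) (hγ : 0 ≤ γ) :
    Tendsto (fun p => testStat γ normalModel est est₀ p.1 p.2 -
      normalPeak (θ₀ 1) ^ γ / √(1 + γ) / locInfo β ^ 2 * (p.1 * (scoreAvg β θ₀ X p).1 ^ 2))
      (inProb P atTop) (𝓝 0) := by
  have hβ₁ : 0 < 1 + β := by linarith
  have hβ₂ : 0 < 1 + 2 * β := by linarith
  have hdiv := (Asymptotics.isBigO_refl (fun p : ℕ × Ω => (p.1 : ℝ)) _).mul_isLittleO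
    ((isLittleO_two_mul_divergence_sub hest hest₀ hX hθ₀ hβ hγ).trans_isBigO
      (.of_norm_le fun p => by simpa using norm_sq_le_fst_sq_add_snd_sq (scoreAvg β θ₀ X p)))
  have hbound (n : ℕ) : ∫ ω, ‖n * ((scoreAvg β θ₀ X (n, ω)).1 ^ 2 +
      (scoreAvg β θ₀ X (n, ω)).2 ^ 2)‖ ∂P ≤
        ∫ z, locScore β z ^ 2 ∂gaussianReal 0 1 + ∫ z, scaleScore β z ^ 2 ∂gaussianReal 0 1 := by
    have hnonneg (ω : Ω) : 0 ≤ n * ((scoreAvg β θ₀ X (n, ω)).1 ^ 2 +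
        (scoreAvg β θ₀ X (n, ω)).2 ^ 2) := by positivity
    simp only [Real.norm_of_nonneg (hnonneg _), integral_const_mul]
    exact hX.mul_integral_scoreAvg_sq_le hθ₀ hβ₁ hβ₂ n
  refine (tendsto_zero_of_isLittleO_of_integral_norm_le hdiv
    (fun n => (hX.integrable_scoreAvg_sq hθ₀ hβ₂ n).const_mul (n : ℝ)) hbound).congr fun p => ?_
  rw [testStat]
  ring

end FiniteMeasure

lemma tendstoInDistribution_testStat [IsProbabilityMeasure P]
    (hest : IsMDPDE P β normalModel normalSpace θ₀ X est)
    (hest₀ : IsRMDPDE P β normalModel normalSpace (normalNull (θ₀ 0)) θ₀ X est₀)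
    (hX : IsIIDSample X (gaussianReal (θ₀ 0) (θ₀ 1 ^ 2).toNNReal) P) (hθ₀ : 0 < θ₀ 1)
    (hβ : 0 ≤ β) (hγ : 0 ≤ γ) :
    TendstoInDistribution (testStat γ normalModel est est₀) atTop
      (fun z => normalEigenvalue (θ₀ 1) β γ * z ^ 2) (fun _ => P) (gaussianReal 0 1) := by
  have hβ₁ : 0 < 1 + β := by linarith
  have hβ₂ : 0 < 1 + 2 * β := by linarith
  have hclt := ((hX.standardize hθ₀).tendstoInDistribution_mul_avg_sq measurable_locScore
    (memLp_locScore hβ₂) (integral_locScore hβ₁)).continuous_comp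
    (continuous_const_mul (normalPeak (θ₀ 1) ^ γ / √(1 + γ) / locInfo β ^ 2))
  have hlimit : (fun z => normalEigenvalue (θ₀ 1) β γ * z ^ 2) =
      fun z => normalPeak (θ₀ 1) ^ γ / √(1 + γ) / locInfo β ^ 2 *
        ((∫ y, locScore β y ^ 2 ∂gaussianReal 0 1) * z ^ 2) := by
    ext z
    rw [normalEigenvalue_eq hθ₀ hβ hγ, integral_locScore_sq hβ₂]
    ring
  rw [hlimit]
  exact tendstoInDistribution_of_tendstoInMeasure_sub _ _ hclt
    (tendsto_inProb_iff_tendstoInMeasure.1 (tendsto_testStat_sub hest hest₀ hX hθ₀ hβ hγ))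
    fun n => (measurable_testStat hest.1 hest₀.1 n).aemeasurable

end TestStatistic

end

end DPD

theorem corollary4 (μ₀ σ β γ : ℝ) (hσ : 0 < σ) (hβ : 0 ≤ β) (hγ : 0 ≤ γ) :
    -- the matrix `A_γ B_β K_β B_β` at the true parameter `(μ₀, σ)`
    DPD.matA γ DPD.normalModel ![μ₀, σ] *
        DPD.matB β DPD.normalModel (DPD.normalNull μ₀) ![μ₀, σ] *
        DPD.matK β DPD.normalModel ![μ₀, σ] *
        DPD.matB β DPD.normalModel (DPD.normalNull μ₀) ![μ₀, σ] =
      !![DPD.normalEigenvalue σ β γ, 0; 0, 0] ∧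
    -- its only nonzero eigenvalue
    DPD.normalEigenvalue σ β γ ≠ 0 ∧
    (∀ r : ℝ, r ≠ 0 →
      (Module.End.HasEigenvalue
        (Matrix.toLin' (DPD.matA γ DPD.normalModel ![μ₀, σ] *
          DPD.matB β DPD.normalModel (DPD.normalNull μ₀) ![μ₀, σ] *
          DPD.matK β DPD.normalModel ![μ₀, σ] *
          DPD.matB β DPD.normalModel (DPD.normalNull μ₀) ![μ₀, σ])) r ↔
        r = DPD.normalEigenvalue σ β γ)) ∧
    (β = 0 → γ = 0 → DPD.normalEigenvalue σ β γ = 1) ∧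
    -- the asymptotic null distribution of the test statistic
    (∀ {Ω : Type*} [MeasurableSpace Ω] (P : Measure Ω) [IsProbabilityMeasure P]
      (X : ℕ → Ω → ℝ) (est est₀ : ℕ → Ω → Fin 2 → ℝ),
      (∀ k, Measurable (X k)) → iIndepFun X P →
      (∀ k, P.map (X k) = gaussianReal μ₀ (Real.toNNReal (σ ^ 2))) →
      DPD.IsMDPDE P β DPD.normalModel DPD.normalSpace ![μ₀, σ] X est →
      DPD.IsRMDPDE P β DPD.normalModel DPD.normalSpace (DPD.normalNull μ₀) ![μ₀, σ] X est₀ →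
      TendstoInDistribution (DPD.testStat γ DPD.normalModel est est₀) atTop
          (fun z : ℝ => DPD.normalEigenvalue σ β γ * z ^ 2) (fun _ => P) (gaussianReal 0 1) ∧
        (β = 0 → γ = 0 →
          TendstoInDistribution (DPD.testStat γ DPD.normalModel est est₀) atTop
            (fun z : ℝ => z ^ 2) (fun _ => P) (gaussianReal 0 1))) := by
  have hone (hβ₀ : β = 0) (hγ₀ : γ = 0) : DPD.normalEigenvalue σ β γ = 1 := by
    rw [hβ₀, hγ₀, DPD.normalEigenvalue_zero_zero]
  have hne : DPD.normalEigenvalue σ β γ ≠ 0 := (DPD.normalEigenvalue_pos hσ hβ hγ).ne'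
  have hmat := DPD.matA_mul_matB_mul_matK_mul_matB (μ₀ := μ₀) hσ hβ hγ
  refine ⟨hmat, hne, fun r hr => ?_, hone, ?_⟩
  · rw [hmat, DPD.hasEigenvalue_toLin'_single_iff hne hr]
  · intro Ω _ P _ X est est₀ hmeas hindep hlaw hest hest₀
    have hX : DPD.IsIIDSample X (gaussianReal μ₀ (σ ^ 2).toNNReal) P := ⟨hmeas, hindep, hlaw⟩
    have hlim := DPD.tendstoInDistribution_testStat (θ₀ := ![μ₀, σ]) hest hest₀ hX hσ hβ hγ
    refine ⟨hlim, fun hβ₀ hγ₀ => ?_⟩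
    simpa only [Matrix.cons_val_one, Matrix.cons_val_fin_one, hone hβ₀ hγ₀, one_mul] using hlim
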